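/- Notation. $\|\cdot\|_2$ is the spectral norm, $\kappa(F)=\|F\|_2\|F^{-1}\|_2$, $\lambda_{\min}$ is the smallest eigenvalue of a symmetric matrix, and $\sigma_1(M)\ge\sigma_2(M)\ge\dots$ are the singular values of $M$, continued by zeros. For a matrix $M\in\mathbb R^{m\times m}$ that is diagonalizable over $\mathbb C$, $\kappa_{\mathrm{eig}}(M)=\inf\|V\|_2\|V^{-1}\|_2$ over all invertible $V\in\mathbb C^{m\times m}$ with $V^{-1}MV$ diagonal. For $M\in\mathbb R^{n\times n}$, $\mathrm{Off}(M)$ is the set of the blocks $M(s+1:n,\,1:s)$ and $M(1:s,\,s+1:n)$, $s=1,\dots,n-1$, and the quasiseparable order of $M$ is the largest rank of a block in $\mathrm{Off}(M)$ ($0$ if $n=1$). For $E,G\subset\mathbb C$, $$Z_h(E,G)=\inf_{g}\ \frac{\sup_{z\in E}|g(z)|}{\inf_{z\in G}|g(z)|},$$ where $g$ ranges over the rational functions with numerator and denominator of degree at most $h$, without poles in $E$ and without zeros in $G$ ($|g|=\infty$ at poles). Statement. Let $n\ge 1$ and let $A,F,Q\in\mathbb R^{n\times n}$ have quasiseparable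 orders $r_a,r_f,r_q$. Assume that the numerical range $\{x^HAx: x\in\mathbb C^n,\ \|x\|_2=1\}$ of $A$ lies in $\{\Re z<0\}$ and that $F$ and $Q$ are symmetric positive definite. Let $X$ be the symmetric positive semidefinite stabilizing solution of $$A^\top X+XA-XFX+Q=0,$$ stabilizing meaning that all eigenvalues of $A-FX$ have non-positive real part. For $j=1,\dots,n$ let $A^{(j)},F^{(j)},Q^{(j)}$ and $A_{(j)},F_{(j)},Q_{(j)}$ be the principal submatrices of $A,F,Q$ for the first, respectively the last, $j$ indices, let $X^{(j)},X_{(j)}$ be the symmetric positive semidefinite stabilizing solutions of the Riccati equations with these coefficients, and let $C^{(j)}=A^{(j)}-F^{(j)}X^{(j)}$, $C_{(j)}=A_{(j)}-F_{(j)}X_{(j)}$ be the closed-loop matrices. Assume that all $C^{(j)}$ and $C_{(j)}$ are diagonalizable over $\mathbb C$, and put $t=4r_a+2r_f+2r_q$, $$\mathfrak K=\kappa_{\mathrm{eig}}(A-FX)\cdot\max\Big\{\max_{1\le j\le n}\kappa_{\mathrm{eig}}(C^{(j)}),\ \max_{1\le j\le n}\kappa_{\mathrm{eig}}(C_{(j)})\Big\},$$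 $$r_\ell=\sqrt{\frac{\lambda_{\min}(Q)}{3\|F^{-1}\|_2}},\qquad r_u=\|A\|_2\sqrt{\kappa(F)}+\sqrt{2\|A\|_2^2\,\kappa(F)+\|Q\|_2\|F\|_2}.$$ Then there exists $\tau>0$, namely the number for which $-\tau$ is the largest real part of an eigenvalue of the matrices $C^{(j)},C_{(j)}$ $(1\le j\le n)$, such that the set $$E=\{z\in\mathbb C:\ \Re z\le-\tau,\ r_\ell\le|z|\le r_u\}$$ contains all eigenvalues of all $C^{(j)}$ and $C_{(j)}$, and every $M\in\mathrm{Off}(X)$ satisfies $$\frac{\sigma_{ht+1}(M)}{\|X\|_2}\le\mathfrak K\cdot Z_h(E,-E),\qquad h=1,2,\dots$$ Additionally, if $L$ is the Cholesky factor of $F$ (lower triangular with positive diagonal, $LL^\top=F$) and $$\frac{\|L^\top AL^{-\top}-L^{-1}A^\top L\|_2^2}{4}<\frac{\lambda_{\min}(Q)}{\|F^{-1}\|_2},$$ then $$\tau\ \ge\ \sqrt{\frac{\lambda_{\min}(Q)}{\|F^{-1}\|_2}-\frac{\|L^\top AL^{-\top}-L^{-1}A^\top L\|_2^2}{4}}\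 >\ 0.$$ -/

import Mathlib

/-! Matrix norms below are spectral norms (operator 2-norms). -/

open scoped Matrix Matrix.Norms.L2Operator Pointwise ENNReal

noncomputable section

namespace Riccati

/-- A real matrix regarded as a complex matrix. -/
def complexify {p q : ℕ} (M : Matrix (Fin p) (Fin q) ℝ) : Matrix (Fin p) (Fin q) ℂ :=
  M.map Complex.ofReal

/-- The numerical range `{xᴴ A x : x ∈ ℂⁿ, ‖x‖₂ = 1}`. -/
def numRange {n : ℕ} (A : Matrix (Fin n) (Fin n) ℝ) : Set ℂ :=
  {z | ∃ x : EuclideanSpace ℂ (Fin n), ‖x‖ = 1 ∧ z = star x.ofLp ⬝ᵥ (complexify A *ᵥ x.ofLp)}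

/-- The set of complex eigenvalues of a real square matrix. -/
def eigs {n : ℕ} (M : Matrix (Fin n) (Fin n) ℝ) : Set ℂ := spectrum ℂ (complexify M)

/-- The smallest eigenvalue of a real symmetric matrix. -/
def lambdaMin {n : ℕ} (M : Matrix (Fin n) (Fin n) ℝ) : ℝ := sInf (spectrum ℝ M)

/-- The 2-norm condition number of an invertible matrix. -/
def cond2 {n : ℕ} (M : Matrix (Fin n) (Fin n) ℝ) : ℝ := ‖M‖ * ‖M⁻¹‖

/-- The complex matrix `V` is an eigenvector matrix of `M`: it is invertible and
`M V = V D` with `D` diagonal. -/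
def IsEigenvectorMatrix {n : ℕ} (M : Matrix (Fin n) (Fin n) ℝ) (V : Matrix (Fin n) (Fin n) ℂ) :
    Prop :=
  IsUnit V ∧ ∃ d : Fin n → ℂ, complexify M * V = V * Matrix.diagonal d

/-- `M` is diagonalizable over `ℂ`. -/
def IsDiagonalizable {n : ℕ} (M : Matrix (Fin n) (Fin n) ℝ) : Prop :=
  ∃ V, IsEigenvectorMatrix M V

/-- The eigenvector condition number of a diagonalizable matrix, for the best choice of the
eigenvector matrix. -/
def kappaEig {n : ℕ} (M : Matrix (Fin n) (Fin n) ℝ) : ℝ :=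
  sInf ((fun V : Matrix (Fin n) (Fin n) ℂ => ‖V‖ * ‖V⁻¹‖) '' {V | IsEigenvectorMatrix M V})

/-- The singular values `σ₁ ≥ σ₂ ≥ …` of a matrix, numbered from `1` and continued by zeros
(Mathlib numbers them from `0`). -/
def sigma {p q : ℕ} (M : Matrix (Fin p) (Fin q) ℝ) (i : ℕ) : ℝ :=
  (Matrix.toEuclideanLin M).singularValues (i - 1)

/-- The first `j` of `n` indices. -/
def firstIdx {j n : ℕ} (hj : j ≤ n) : Fin j → Fin n := Fin.castLE hj

/-- The last `j` of `n` indices. -/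
def lastIdx {j n : ℕ} (hj : j ≤ n) : Fin j → Fin n := fun i => ⟨n - j + i, by omega⟩

/-- The leading principal submatrix `M^{(j)}` of order `j`. -/
def leading {n j : ℕ} (M : Matrix (Fin n) (Fin n) ℝ) (hj : j ≤ n) : Matrix (Fin j) (Fin j) ℝ :=
  M.submatrix (firstIdx hj) (firstIdx hj)

/-- The trailing principal submatrix `M_{(j)}` of order `j`. -/
def trailing {n j : ℕ} (M : Matrix (Fin n) (Fin n) ℝ) (hj : j ≤ n) : Matrix (Fin j) (Fin j) ℝ :=
  M.submatrix (lastIdx hj) (lastIdx hj)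

/-- The set `Off(M)` of the maximal off-diagonal blocks `M(s+1:n, 1:s)` and `M(1:s, s+1:n)`,
`s = 1, …, n-1`, each together with its numbers of rows and columns. -/
def Off {n : ℕ} (M : Matrix (Fin n) (Fin n) ℝ) :
    Set ((p : ℕ) × (q : ℕ) × Matrix (Fin p) (Fin q) ℝ) :=
  {B | ∃ (s : ℕ) (_ : 1 ≤ s) (hs : s < n),
    B = ⟨n - s, s, M.submatrix (lastIdx (Nat.sub_le n s)) (firstIdx hs.le)⟩ ∨
    B = ⟨s, n - s, M.submatrix (firstIdx hs.le) (lastIdx (Nat.sub_le n s))⟩}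

/-- The quasiseparable order: the largest rank of a block in `Off(M)` (`0` if there is none). -/
def qsrank {n : ℕ} (M : Matrix (Fin n) (Fin n) ℝ) : ℕ :=
  sSup ((fun B => B.2.2.rank) '' Off M)

/-- The closed-loop matrix `A - F X`. -/
def closedLoop {n : ℕ} (A F X : Matrix (Fin n) (Fin n) ℝ) : Matrix (Fin n) (Fin n) ℝ := A - F * X

/-- `X` is a symmetric positive semidefinite stabilizing solution of
`Aᵀ X + X A - X F X + Q = 0`. -/
structure IsStabilizingSolution {n : ℕ} (A F Q X : Matrix (Fin n) (Fin n) ℝ) : Prop where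
  posSemidef : X.PosSemidef
  care : Aᵀ * X + X * A - X * F * X + Q = 0
  stable : ∀ z ∈ eigs (closedLoop A F X), z.re ≤ 0

/-- `L` is the Cholesky factor of `F`: lower triangular with positive diagonal, `L Lᵀ = F`. -/
structure IsCholeskyFactor {n : ℕ} (L F : Matrix (Fin n) (Fin n) ℝ) : Prop where
  lower : ∀ i j, i < j → L i j = 0
  diag_pos : ∀ i, 0 < L i i
  mul_transpose : L * Lᵀ = F

/-- The modulus `|g(z)| ∈ [0, ∞]` of a rational function, `∞` at its poles (numerator and
denominator are coprime, so `0 / 0` does not occur). -/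
def ratAbs (g : RatFunc ℂ) (z : ℂ) : ℝ≥0∞ := ‖g.num.eval z‖ₑ / ‖g.denom.eval z‖ₑ

/-- The rational functions with numerator and denominator of degree at most `h`. -/
def ratDeg (h : ℕ) : Set (RatFunc ℂ) := {g | g.num.natDegree ≤ h ∧ g.denom.natDegree ≤ h}

/-- The Zolotarev number: the infimum of `max_E |g| / min_F |g|` over the rational functions `g`
of type `(h, h)` without poles in `E` and without zeros in `F` (the others do not give a finite
quotient). -/
def zolotarev (h : ℕ) (E F : Set ℂ) : ℝ≥0∞ :=
  ⨅ g ∈ {g ∈ ratDeg h | (∀ z ∈ E, g.denom.eval z ≠ 0) ∧ (∀ z ∈ F, g.num.eval z ≠ 0)},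
    (⨆ z ∈ E, ratAbs g z) / (⨅ z ∈ F, ratAbs g z)

/-- The part of the annulus `rl ≤ |z| ≤ ru` in the half plane `Re z ≤ -τ`. -/
def annulusPart (τ rl ru : ℝ) : Set ℂ := {z | z.re ≤ -τ ∧ rl ≤ ‖z‖ ∧ ‖z‖ ≤ ru}

/-- The inner radius `√(λ_min(Q) / (3 ‖F⁻¹‖₂))`. -/
def rLower {n : ℕ} (F Q : Matrix (Fin n) (Fin n) ℝ) : ℝ := √(lambdaMin Q / (3 * ‖F⁻¹‖))

/-- The outer radius `‖A‖₂ √κ(F) + √(2 ‖A‖₂² κ(F) + ‖Q‖₂ ‖F‖₂)`. -/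
def rUpper {n : ℕ} (A F Q : Matrix (Fin n) (Fin n) ℝ) : ℝ :=
  ‖A‖ * √(cond2 F) + √(2 * ‖A‖ ^ 2 * cond2 F + ‖Q‖ * ‖F‖)

/-- The constant `κ_eig(A - F X) · max {max_j κ_eig(C^{(j)}), max_j κ_eig(C_{(j)})}`, where
`C^{(j)}` and `C_{(j)}`, `1 ≤ j ≤ n`, are the closed-loop matrices of the leading and trailing
principal subproblems with solutions `Xl j` and `Xt j`. -/
def kappaConst {n : ℕ} (A F X : Matrix (Fin n) (Fin n) ℝ)
    (Xl Xt : ∀ j : ℕ, Matrix (Fin j) (Fin j) ℝ) : ℝ :=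
  kappaEig (closedLoop A F X) *
    max (⨆ j : Set.Icc 1 n, kappaEig (closedLoop (leading A j.2.2) (leading F j.2.2) (Xl j)))
      (⨆ j : Set.Icc 1 n, kappaEig (closedLoop (trailing A j.2.2) (trailing F j.2.2) (Xt j)))

/-- All the eigenvalues of the closed-loop matrices `C^{(j)}` and `C_{(j)}`, `1 ≤ j ≤ n`. -/
def subproblemEigs {n : ℕ} (A F : Matrix (Fin n) (Fin n) ℝ)
    (Xl Xt : ∀ j : ℕ, Matrix (Fin j) (Fin j) ℝ) : Set ℂ :=
  (⋃ j : Set.Icc 1 n, eigs (closedLoop (leading A j.2.2) (leading F j.2.2) (Xl j))) ∪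
    (⋃ j : Set.Icc 1 n, eigs (closedLoop (trailing A j.2.2) (trailing F j.2.2) (Xt j)))

end Riccati

end

open Riccati

/-!
Let `J` be the diagonal sign matrix that is `1` on one group of indices and `-1` on the other. Then
`J * X * J` solves the Riccati equation with the conjugated coefficients `J * A * J`, `J * F * J`,
`J * Q * J`, and `δ = (X - J * X * J) / 2` consists of the two off-diagonal blocks of `X`.
Subtracting the equations, and writing `C = A - F * X`, shows that `-Cᵀ * δ - δ * (J * C * J)`
involves only the off-diagonal blocks of the coefficients, hence has rank at most `t`. For
polynomials `p` and `q` of degree at most `h`, the matrix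
`p(-Cᵀ)⁻¹ * q(-Cᵀ) * δ * q(J * C * J)⁻¹ * p(J * C * J)` differs from `δ` by a matrix of rank at most
`h * t`, and its norm is governed by `q / p` on the spectrum of `-Cᵀ` and `p / q` on that of
`J * C * J`; the infimum over `p` and `q` is a Zolotarev number.

The spectra are located by `(A - F * X)ᴴ * F⁻¹ * (A - F * X) = Aᴴ * F⁻¹ * A + Q`, another form of
the Riccati equation. It persists when `A` is replaced by `A - iω`, so that taking `ω = Im z` for an
eigenvalue `z` of `C` bounds `|Re z|` from below.
-/

namespace Riccati

open Matrix Module Polynomial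
open scoped MatrixOrder ComplexOrder

section DisplacementRank

lemma aeval_eq_mul_aeval_divX_add {R A : Type*} [CommSemiring R] [Semiring A] [Algebra R A] (x : A)
    (p : R[X]) : aeval x p = x * aeval x p.divX + p.coeff 0 • 1 := by
  conv_lhs => rw [← X_mul_divX_add p, map_add, map_mul, aeval_X, aeval_C,
    Algebra.algebraMap_eq_smul_one]

variable {m n K : Type*} [Fintype n] [Field K]

lemma rank_add_le (M N : Matrix m n K) : (M + N).rank ≤ M.rank + N.rank := by
  rw [rank, rank, rank, mulVecLin_add]
  exact (Submodule.finrank_mono (LinearMap.range_add_le _ _)).trans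
    (Submodule.finrank_add_le_finrank_add_finrank _ _)

lemma rank_sum_le_card_mul {ι : Type*} (s : Finset ι) {M : ι → Matrix m n K} {r : ℕ}
    (h : ∀ i ∈ s, (M i).rank ≤ r) : (∑ i ∈ s, M i).rank ≤ s.card * r := by
  classical
  induction s using Finset.induction_on with
  | empty => simp
  | insert i s hi ih =>
    rw [Finset.sum_insert hi, Finset.card_insert_of_notMem hi, add_one_mul, add_comm]
    exact (rank_add_le _ _).trans
      (add_le_add (ih fun j hj => h j (Finset.mem_insert_of_mem hj)) (h i (s.mem_insert_self i)))

variable [Fintype m] [DecidableEq m] [DecidableEq n] (B : Matrix m m K) (N : Matrix n n K)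
  (Z : Matrix m n K)

lemma exists_aeval_mul_sub_mul_aeval_eq_sum {h : ℕ} {p : K[X]} (hp : p.natDegree ≤ h) :
    ∃ P : ℕ → Matrix n n K,
      aeval B p * Z - Z * aeval N p = ∑ i ∈ Finset.range h, B ^ i * (B * Z - Z * N) * P i := by
  induction h generalizing p with
  | zero =>
    obtain ⟨a, rfl⟩ := natDegree_eq_zero.1 (Nat.le_zero.1 hp)
    exact ⟨0, by simp [Algebra.algebraMap_eq_smul_one]⟩
  | succ h ih =>
    obtain ⟨P, hP⟩ := ih (p := p.divX) (by rw [natDegree_divX_eq_natDegree_tsub_one]; omega)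
    refine ⟨fun i => i.casesOn (aeval N p.divX) P, ?_⟩
    have hsplit : aeval B p * Z - Z * aeval N p =
        B * (aeval B p.divX * Z - Z * aeval N p.divX) + (B * Z - Z * N) * aeval N p.divX := by
      rw [aeval_eq_mul_aeval_divX_add B, aeval_eq_mul_aeval_divX_add N]
      simp only [Matrix.add_mul, Matrix.mul_add, Matrix.mul_sub, Matrix.sub_mul, Matrix.mul_assoc,
        Matrix.smul_mul, Matrix.mul_smul, Matrix.one_mul, Matrix.mul_one]
      abel
    rw [hsplit, hP, Finset.sum_range_succ', Matrix.mul_sum]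
    simp [pow_succ', Matrix.mul_assoc]

theorem rank_aeval_mul_mul_aeval_sub_le {h : ℕ} {p q : K[X]} (hp : p.natDegree ≤ h)
    (hq : q.natDegree ≤ h) :
    (aeval B p * Z * aeval N q - aeval B q * Z * aeval N p).rank ≤ h * (B * Z - Z * N).rank := by
  obtain ⟨P, hP⟩ := exists_aeval_mul_sub_mul_aeval_eq_sum B N Z hp
  obtain ⟨R, hR⟩ := exists_aeval_mul_sub_mul_aeval_eq_sum B N Z hq
  have hbezout : aeval B p * Z * aeval N q - aeval B q * Z * aeval N p =
      (aeval B p * Z - Z * aeval N p) * aeval N q -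
        (aeval B q * Z - Z * aeval N q) * aeval N p := by
    have hcomm : aeval N p * aeval N q = aeval N q * aeval N p := by
      rw [← map_mul, mul_comm, map_mul]
    rw [Matrix.sub_mul, Matrix.sub_mul, Matrix.mul_assoc Z, Matrix.mul_assoc Z, hcomm]
    abel
  have hsum : aeval B p * Z * aeval N q - aeval B q * Z * aeval N p = ∑ i ∈ Finset.range h,
      B ^ i * (B * Z - Z * N) * (P i * aeval N q - R i * aeval N p) := by
    rw [hbezout, hP, hR, Matrix.sum_mul, Matrix.sum_mul, ← Finset.sum_sub_distrib]
    simp only [Matrix.mul_sub (_ * _), Matrix.mul_assoc]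
  rw [hsum]
  simpa only [Finset.card_range] using rank_sum_le_card_mul (Finset.range h) fun i _ =>
    (rank_mul_le_left _ _).trans (rank_mul_le_right _ _)

variable {B N Z} in
lemma aeval_mul_eq_mul_aeval (h : B * Z = Z * N) (p : K[X]) : aeval B p * Z = Z * aeval N p := by
  obtain ⟨P, hP⟩ := exists_aeval_mul_sub_mul_aeval_eq_sum B N Z (le_refl p.natDegree)
  rw [← sub_eq_zero, hP, h, sub_self]
  simp

lemma aeval_diagonal (d : n → K) (p : K[X]) :
    aeval (diagonal d) p = diagonal fun i => p.eval (d i) := by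
  have := aeval_algHom_apply (diagonalAlgHom (n := n) (α := K) K) d p
  rw [diagonalAlgHom_apply, diagonalAlgHom_apply] at this
  rw [this]
  exact congrArg diagonal (aeval_pi_apply d p)

variable {B N} in
theorem rank_sub_mul_mul_le {h : ℕ} {p q : K[X]} (hp : p.natDegree ≤ h) (hq : q.natDegree ≤ h)
    (hB : IsUnit (aeval B p)) (hN : IsUnit (aeval N q)) :
    (Z - (aeval B p)⁻¹ * aeval B q * Z * ((aeval N q)⁻¹ * aeval N p)).rank ≤
      h * (B * Z - Z * N).rank := by
  have hBdet := (isUnit_iff_isUnit_det _).1 hB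
  have hNdet := (isUnit_iff_isUnit_det _).1 hN
  have hcomm : (aeval N q)⁻¹ * aeval N p = aeval N p * (aeval N q)⁻¹ := by
    rw [← mul_nonsing_inv_cancel_right _ ((aeval N q)⁻¹ * aeval N p) hNdet,
      Matrix.mul_assoc _ _ (aeval N q), ← map_mul, mul_comm p, map_mul,
      nonsing_inv_mul_cancel_left _ _ hNdet]
  have hfactor : Z - (aeval B p)⁻¹ * aeval B q * Z * ((aeval N q)⁻¹ * aeval N p) = (aeval B p)⁻¹ *
      (aeval B p * Z * aeval N q - aeval B q * Z * aeval N p) * (aeval N q)⁻¹ := by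
    simp only [hcomm, Matrix.mul_sub, Matrix.sub_mul, Matrix.mul_assoc, mul_nonsing_inv _ hNdet,
      nonsing_inv_mul_cancel_left _ _ hBdet, Matrix.mul_one]
  rw [hfactor]
  exact (rank_mul_le_left _ _).trans
    ((rank_mul_le_right _ _).trans (rank_aeval_mul_mul_aeval_sub_le B N Z hp hq))

variable {B N Z} in
lemma eq_zero_of_mul_eq_mul_of_disjoint_spectrum [IsAlgClosed K] (h : B * Z = Z * N)
    (hdisj : Disjoint (spectrum K B) (spectrum K N)) : Z = 0 := by
  have hunit : IsUnit (aeval B N.charpoly) := by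
    by_contra hsing
    cases isEmpty_or_nonempty m
    · exact hsing (isUnit_of_subsingleton _)
    rw [← spectrum.zero_mem_iff K, spectrum.map_polynomial_aeval_of_nonempty _ _
      (spectrum.nonempty_of_isAlgClosed_of_finiteDimensional K B)] at hsing
    obtain ⟨μ, hμ, hroot⟩ := hsing
    exact hdisj.ne_of_mem hμ (mem_spectrum_iff_isRoot_charpoly.2 hroot) rfl
  have hzero := aeval_mul_eq_mul_aeval h N.charpoly
  rw [aeval_self_charpoly, Matrix.mul_zero] at hzero
  rw [← nonsing_inv_mul_cancel_left _ Z ((isUnit_iff_isUnit_det _).1 hunit), hzero, Matrix.mul_zero]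

lemma mem_spectrum_of_mul_eq_mul_diagonal {B V : Matrix n n K} {b : n → K} (hV : IsUnit V)
    (h : B * V = V * diagonal b) (i : n) : b i ∈ spectrum K B := by
  obtain ⟨V, rfl⟩ := hV
  rw [(Units.eq_mul_inv_iff_mul_eq V).2 h, spectrum.units_conjugate, spectrum_diagonal]
  exact Set.mem_range_self i

end DisplacementRank

section EigenvectorBasis

variable {n K : Type*} [Fintype n] [Field K] [DecidableEq n] {B V : Matrix n n K} {b : n → K}
  (hV : IsUnit V) (h : B * V = V * diagonal b)
include h hV

lemma isUnit_aeval_of_mul_eq_mul_diagonal {p : K[X]} (hp : ∀ i, p.eval (b i) ≠ 0) :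
    IsUnit (aeval B p) := by
  obtain ⟨V, rfl⟩ := hV
  rw [← Units.isUnit_mul_units _ V, aeval_mul_eq_mul_aeval h, aeval_diagonal,
    Units.isUnit_units_mul, isUnit_diagonal, Pi.isUnit_iff]
  exact fun i => (hp i).isUnit

lemma inv_aeval_mul_aeval_eq {p : K[X]} (hp : ∀ i, p.eval (b i) ≠ 0) (q : K[X]) :
    (aeval B p)⁻¹ * aeval B q = V * diagonal (fun i => q.eval (b i) / p.eval (b i)) * V⁻¹ := by
  have hpdet := (isUnit_iff_isUnit_det _).1 (isUnit_aeval_of_mul_eq_mul_diagonal hV h hp)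
  have hdiag : diagonal (fun i => p.eval (b i)) * diagonal (fun i => q.eval (b i) / p.eval (b i)) =
      diagonal fun i => q.eval (b i) := by
    simp only [diagonal_mul_diagonal, mul_div_cancel₀ _ (hp _)]
  have hq : aeval B q * V =
      aeval B p * (V * diagonal fun i => q.eval (b i) / p.eval (b i)) := by
    rw [← Matrix.mul_assoc, aeval_mul_eq_mul_aeval h, aeval_mul_eq_mul_aeval h, aeval_diagonal,
      aeval_diagonal, Matrix.mul_assoc, hdiag]
  rw [← mul_nonsing_inv_cancel_right V (aeval B q) ((isUnit_iff_isUnit_det _).1 hV), hq,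
    ← Matrix.mul_assoc, nonsing_inv_mul_cancel_left _ _ hpdet]

end EigenvectorBasis

section BeckermannTownsend

variable {m n : Type*} [Fintype m] [Fintype n] [DecidableEq m] [DecidableEq n]

lemma norm_inv_aeval_mul_aeval_le {B V : Matrix n n ℂ} {b : n → ℂ}
    (hV : IsUnit V) (h : B * V = V * diagonal b) {p q : ℂ[X]} (hp : ∀ i, p.eval (b i) ≠ 0) :
    ‖(aeval B p)⁻¹ * aeval B q‖ ≤ ‖V‖ * ‖V⁻¹‖ * ‖fun i => q.eval (b i) / p.eval (b i)‖ := by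
  rw [inv_aeval_mul_aeval_eq hV h hp, ← l2_opNorm_diagonal]
  exact ((l2_opNorm_mul _ _).trans
    (mul_le_mul_of_nonneg_right (l2_opNorm_mul _ _) (norm_nonneg _))).trans_eq
    (mul_right_comm _ _ _)

theorem exists_rank_le_norm_sub_le {B V : Matrix m m ℂ} {N W : Matrix n n ℂ} {b : m → ℂ}
    {c : n → ℂ} (hV : IsUnit V) (hBV : B * V = V * diagonal b) (hW : IsUnit W)
    (hNW : N * W = W * diagonal c) (Z : Matrix m n ℂ) {h : ℕ} {p q : ℂ[X]} (hp : p.natDegree ≤ h)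
    (hq : q.natDegree ≤ h) (hpb : ∀ i, p.eval (b i) ≠ 0) (hqc : ∀ i, q.eval (c i) ≠ 0) :
    ∃ Y : Matrix m n ℂ, Y.rank ≤ h * (B * Z - Z * N).rank ∧
      ‖Z - Y‖ ≤ ‖V‖ * ‖V⁻¹‖ * (‖W‖ * ‖W⁻¹‖) * ‖Z‖ *
        (‖fun i => q.eval (b i) / p.eval (b i)‖ * ‖fun i => p.eval (c i) / q.eval (c i)‖) := by
  refine ⟨_, rank_sub_mul_mul_le Z hp hq (isUnit_aeval_of_mul_eq_mul_diagonal hV hBV hpb)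
    (isUnit_aeval_of_mul_eq_mul_diagonal hW hNW hqc), ?_⟩
  rw [sub_sub_cancel]
  calc ‖(aeval B p)⁻¹ * aeval B q * Z * ((aeval N q)⁻¹ * aeval N p)‖
      ≤ ‖(aeval B p)⁻¹ * aeval B q‖ * ‖Z‖ * ‖(aeval N q)⁻¹ * aeval N p‖ :=
        (l2_opNorm_mul _ _).trans (mul_le_mul_of_nonneg_right (l2_opNorm_mul _ _) (norm_nonneg _))
    _ ≤ ‖V‖ * ‖V⁻¹‖ * ‖fun i => q.eval (b i) / p.eval (b i)‖ * ‖Z‖ *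
        (‖W‖ * ‖W⁻¹‖ * ‖fun i => p.eval (c i) / q.eval (c i)‖) := by
      gcongr
      exacts [norm_inv_aeval_mul_aeval_le hV hBV hpb, norm_inv_aeval_mul_aeval_le hW hNW hqc]
    _ = _ := by ring

end BeckermannTownsend

section Zolotarev

lemma zolotarev_le_one (h : ℕ) (E G : Set ℂ) : zolotarev h E G ≤ 1 := by
  have hone : ∀ z, ratAbs 1 z = 1 := fun z => by simp [ratAbs]
  refine (iInf₂_le (1 : RatFunc ℂ) ⟨⟨by simp, by simp⟩, by simp, by simp⟩).trans ?_
  simp only [hone]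
  refine ENNReal.div_le_of_le_mul ?_
  rw [one_mul]
  exact (iSup₂_le fun _ _ => le_rfl).trans (le_iInf₂ fun _ _ => le_rfl)

lemma enorm_pi_le {ι : Type*} [Fintype ι] {f : ι → ℂ} {a : ℝ≥0∞} (h : ∀ i, ‖f i‖ₑ ≤ a) :
    ‖f‖ₑ ≤ a := by
  rw [← edist_zero_right, edist_pi_le_iff]
  simpa only [Pi.zero_apply, edist_zero_right] using h

variable {m n : Type*} [Fintype m] [Fintype n] {b : m → ℂ} {c : n → ℂ} {E G : Set ℂ}

lemma enorm_denom_div_num_mul_le (g : RatFunc ℂ) (hb : ∀ i, b i ∈ G) (hc : ∀ i, c i ∈ E)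
    (hnum : ∀ z ∈ G, g.num.eval z ≠ 0) (hden : ∀ z ∈ E, g.denom.eval z ≠ 0) :
    ‖fun i => g.denom.eval (b i) / g.num.eval (b i)‖ₑ *
      ‖fun i => g.num.eval (c i) / g.denom.eval (c i)‖ₑ ≤
      (⨆ z ∈ E, ratAbs g z) / ⨅ z ∈ G, ratAbs g z := by
  rw [div_eq_mul_inv, mul_comm]
  refine mul_le_mul' (enorm_pi_le fun i => ?_) (enorm_pi_le fun i => ?_)
  · rw [div_eq_mul_inv, enorm_mul, enorm_inv (hden _ (hc i)), ← div_eq_mul_inv]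
    exact le_iSup₂ (f := fun z _ => ratAbs g z) (c i) (hc i)
  · rw [div_eq_mul_inv, enorm_mul, enorm_inv (hnum _ (hb i)), ← div_eq_mul_inv,
      ← ENNReal.inv_div (.inr enorm_ne_top) (.inr (enorm_ne_zero.2 (hnum _ (hb i)))),
      ENNReal.inv_le_inv]
    exact iInf₂_le (f := fun z _ => ratAbs g z) (b i) (hb i)

theorem le_mul_toReal_zolotarev (hb : ∀ i, b i ∈ G) (hc : ∀ i, c i ∈ E) {h : ℕ} {s K : ℝ}
    (hK : 0 ≤ K)
    (H : ∀ p q : ℂ[X], p.natDegree ≤ h → q.natDegree ≤ h → (∀ i, p.eval (b i) ≠ 0) →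
      (∀ i, q.eval (c i) ≠ 0) → s ≤ K *
        (‖fun i => q.eval (b i) / p.eval (b i)‖ * ‖fun i => p.eval (c i) / q.eval (c i)‖)) :
    s ≤ K * (zolotarev h E G).toReal := by
  rcases hK.eq_or_lt with rfl | hK0
  · simpa using H 1 1 (by simp) (by simp) (by simp) (by simp)
  rw [← ENNReal.toReal_ofReal hK, ← ENNReal.toReal_mul, ← ENNReal.ofReal_le_iff_le_toReal
    (ENNReal.mul_ne_top ENNReal.ofReal_ne_top
      ((zolotarev_le_one h E G).trans_lt ENNReal.one_lt_top).ne), zolotarev, iInf_subtype',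
    ENNReal.mul_iInf_of_ne (ENNReal.ofReal_pos.2 hK0).ne' ENNReal.ofReal_ne_top]
  refine le_iInf fun ⟨g, hdeg, hden, hnum⟩ => ?_
  refine (ENNReal.ofReal_le_ofReal (H g.num g.denom hdeg.1 hdeg.2 (fun i => hnum _ (hb i))
    fun i => hden _ (hc i))).trans ?_
  rw [ENNReal.ofReal_mul hK, ENNReal.ofReal_mul (norm_nonneg _), ofReal_norm, ofReal_norm]
  exact mul_le_mul_right (enorm_denom_div_num_mul_le g hb hc hnum hden) _

end Zolotarev

section Complexify

lemma complexify_mul {p q r : ℕ} (M : Matrix (Fin p) (Fin q) ℝ) (N : Matrix (Fin q) (Fin r) ℝ) :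
    complexify (M * N) = complexify M * complexify N :=
  Matrix.map_mul (f := Complex.ofRealHom)

lemma conjTranspose_complexify {p q : ℕ} (M : Matrix (Fin p) (Fin q) ℝ) :
    (complexify M)ᴴ = complexify Mᵀ := by
  ext i j
  simp [complexify]

lemma complexify_diagonal {p : ℕ} (d : Fin p → ℝ) :
    complexify (diagonal d) = diagonal fun i => (d i : ℂ) :=
  diagonal_map Complex.ofReal_zero

lemma complexify_zero {p q : ℕ} : complexify (0 : Matrix (Fin p) (Fin q) ℝ) = 0 :=
  Matrix.map_zero _ Complex.ofReal_zero

lemma complexify_one {p : ℕ} : complexify (1 : Matrix (Fin p) (Fin p) ℝ) = 1 :=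
  Matrix.map_one _ Complex.ofReal_zero Complex.ofReal_one

lemma complexify_add {p q : ℕ} (M N : Matrix (Fin p) (Fin q) ℝ) :
    complexify (M + N) = complexify M + complexify N :=
  Matrix.map_add _ Complex.ofReal_add M N

lemma complexify_sub {p q : ℕ} (M N : Matrix (Fin p) (Fin q) ℝ) :
    complexify (M - N) = complexify M - complexify N :=
  Matrix.map_sub _ Complex.ofReal_sub M N

lemma complexify_neg {p q : ℕ} (M : Matrix (Fin p) (Fin q) ℝ) :
    complexify (-M) = -complexify M :=
  Matrix.map_neg _ Complex.ofReal_neg M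

lemma complexify_algebraMap {p : ℕ} (c : ℝ) :
    complexify (algebraMap ℝ (Matrix (Fin p) (Fin p) ℝ) c) =
      algebraMap ℝ (Matrix (Fin p) (Fin p) ℂ) c := by
  rw [algebraMap_eq_diagonal, algebraMap_eq_diagonal]
  exact complexify_diagonal _

lemma complexify_injective {p q : ℕ} :
    Function.Injective (complexify : Matrix (Fin p) (Fin q) ℝ → Matrix (Fin p) (Fin q) ℂ) :=
  Matrix.map_injective Complex.ofReal_injective

lemma posSemidef_complexify {p : ℕ} {M : Matrix (Fin p) (Fin p) ℝ} (hM : M.PosSemidef) :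
    (complexify M).PosSemidef := by
  obtain ⟨B, rfl⟩ := CStarAlgebra.nonneg_iff_eq_star_mul_self.1 hM.nonneg
  rw [complexify_mul, star_eq_conjTranspose, conjTranspose_eq_transpose_of_trivial,
    ← conjTranspose_complexify]
  exact posSemidef_conjTranspose_mul_self _

lemma complexify_mono {p : ℕ} {M N : Matrix (Fin p) (Fin p) ℝ} (h : M ≤ N) :
    complexify M ≤ complexify N := by
  rw [Matrix.le_iff, ← complexify_sub]
  exact posSemidef_complexify (Matrix.le_iff.1 h)

lemma le_algebraMap_norm {n : Type*} [Fintype n] [DecidableEq n] {M : Matrix n n ℝ}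
    (hM : M.IsHermitian) : M ≤ algebraMap ℝ _ ‖M‖ := by
  cases isEmpty_or_nonempty n
  · exact (Subsingleton.elim _ _).le
  exact (le_algebraMap_iff_spectrum_le (a := M) hM.isSelfAdjoint).2 fun c hc =>
    (Real.le_norm_self c).trans (spectrum.norm_le_norm_of_mem hc)

lemma norm_complexify_le {p q : ℕ} (M : Matrix (Fin p) (Fin q) ℝ) : ‖complexify M‖ ≤ ‖M‖ := by
  have hgram : Mᴴ * M ≤ algebraMap ℝ _ (‖M‖ * ‖M‖) := by
    rw [← l2_opNorm_conjTranspose_mul_self]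
    exact le_algebraMap_norm (isHermitian_conjTranspose_mul_self M)
  have hgram' := complexify_mono hgram
  rw [conjTranspose_eq_transpose_of_trivial, complexify_mul, ← conjTranspose_complexify,
    complexify_algebraMap, ← CStarAlgebra.norm_le_iff_le_algebraMap _ (mul_self_nonneg _)
      (posSemidef_conjTranspose_mul_self _).nonneg, l2_opNorm_conjTranspose_mul_self] at hgram'
  exact (mul_self_le_mul_self_iff (norm_nonneg _) (norm_nonneg _)).2 hgram'

lemma exists_eq_mul_of_rank {K m n : Type*} [Field K] [Fintype n] (M : Matrix m n K) :
    ∃ (B : Matrix m (Fin M.rank) K) (C : Matrix (Fin M.rank) n K), M = B * C := by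
  classical
  let b : Basis (Fin M.rank) K (LinearMap.range M.mulVecLin) := finBasis K _
  refine ⟨LinearMap.toMatrix'
      ((LinearMap.range M.mulVecLin).subtype ∘ₗ b.equivFun.symm.toLinearMap),
    LinearMap.toMatrix' (b.equivFun.toLinearMap ∘ₗ M.mulVecLin.rangeRestrict), ?_⟩
  rw [← LinearMap.toMatrix'_comp, LinearMap.comp_assoc,
    ← LinearMap.comp_assoc _ _ b.equivFun.symm.toLinearMap, LinearEquiv.symm_comp,
    LinearMap.id_comp, LinearMap.rangeRestrict, LinearMap.subtype_comp_codRestrict]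
  exact (LinearMap.toMatrix'_toLin' M).symm

lemma rank_complexify_le {p q : ℕ} (M : Matrix (Fin p) (Fin q) ℝ) :
    (complexify M).rank ≤ M.rank := by
  obtain ⟨B, C, h⟩ := exists_eq_mul_of_rank M
  calc (complexify M).rank = (complexify B * complexify C).rank := by rw [← complexify_mul, ← h]
    _ ≤ (complexify B).rank := rank_mul_le_left _ _
    _ ≤ M.rank := rank_le_width _

lemma complexify_care {n : ℕ} {A F Q X : Matrix (Fin n) (Fin n) ℝ}
    (h : Aᵀ * X + X * A - X * F * X + Q = 0) :
    (complexify A)ᴴ * complexify X + complexify X * complexify A -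
      complexify X * complexify F * complexify X + complexify Q = 0 := by
  simpa only [complexify_add, complexify_sub, complexify_mul, conjTranspose_complexify,
    complexify_zero] using congrArg complexify h

lemma complexify_closedLoop {n : ℕ} (A F X : Matrix (Fin n) (Fin n) ℝ) :
    complexify (closedLoop A F X) = complexify A - complexify F * complexify X := by
  rw [closedLoop, complexify_sub, complexify_mul]

end Complexify

section SingularValues

lemma star_dotProduct_self_eq {ι : Type*} [Fintype ι] (x : ι → ℂ) :
    star x ⬝ᵥ x = ((‖WithLp.toLp 2 x‖ ^ 2 : ℝ) : ℂ) := by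
  rw [EuclideanSpace.norm_sq_eq, dotProduct, Complex.ofReal_sum]
  exact Finset.sum_congr rfl fun i _ => (Complex.conj_mul' (x i)).trans (by push_cast; rfl)

lemma norm_sq_mulVec_of_conjTranspose_mul_self_eq_diagonal {m n : Type*} [Fintype m] [Fintype n]
    [DecidableEq n] {M : Matrix m n ℂ} {d : n → ℝ}
    (h : Mᴴ * M = diagonal fun k => (d k : ℂ)) (x : n → ℂ) :
    ‖WithLp.toLp 2 (M *ᵥ x)‖ ^ 2 = ∑ k, d k * ‖x k‖ ^ 2 := by
  refine Complex.ofReal_injective ?_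
  rw [← star_dotProduct_self_eq, star_mulVec, ← dotProduct_mulVec, mulVec_mulVec, h, dotProduct,
    Complex.ofReal_sum]
  refine Finset.sum_congr rfl fun k _ => ?_
  rw [mulVec_diagonal, Pi.star_apply, Complex.ofReal_mul, Complex.ofReal_pow, ← Complex.conj_mul']
  exact mul_left_comm _ _ _

lemma exists_transpose_mul_self_eq_diagonal_sigma_sq {p q k : ℕ} (M : Matrix (Fin p) (Fin q) ℝ)
    (hk : k ≤ q) : ∃ U : Matrix (Fin q) (Fin k) ℝ,
      Uᵀ * U = 1 ∧ (M * U)ᵀ * (M * U) = diagonal fun i : Fin k => sigma M (i + 1) ^ 2 := by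
  let T := toEuclideanLin M
  let v := T.isSymmetric_adjoint_comp_self.eigenvectorBasis finrank_euclideanSpace_fin
  have horth (i j : Fin k) : inner ℝ (v (Fin.castLE hk i)) (v (Fin.castLE hk j)) =
      (1 : Matrix (Fin k) (Fin k) ℝ) i j := by
    rw [v.inner_eq_ite, one_apply]
    simp
  have hgram (i : Fin k) (y : EuclideanSpace ℝ (Fin q)) : inner ℝ (T (v (Fin.castLE hk i))) (T y) =
      sigma M (i + 1) ^ 2 * inner ℝ (v (Fin.castLE hk i)) y := by
    have heig := T.isSymmetric_adjoint_comp_self.apply_eigenvectorBasis finrank_euclideanSpace_fin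
      (Fin.castLE hk i)
    rw [← LinearMap.adjoint_inner_left, ← LinearMap.comp_apply, heig,
      ← T.sq_singularValues_fin finrank_euclideanSpace_fin, inner_smul_left]
    rfl
  have hentry {l : ℕ} (x y : Fin k → EuclideanSpace ℝ (Fin l)) (i j : Fin k) :
      ((Matrix.of fun a i => x i a)ᵀ * Matrix.of fun a i => y i a) i j = inner ℝ (x i) (y j) := by
    simp [mul_apply, PiLp.inner_apply, mul_comm]
  refine ⟨Matrix.of fun a i => v (Fin.castLE hk i) a, ?_, ?_⟩
  · ext i j
    rw [hentry, horth]
  · have hMv : M * Matrix.of (fun a i => v (Fin.castLE hk i) a) =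
        Matrix.of fun a i => T (v (Fin.castLE hk i)) a := by
      ext a i
      simp [T, mul_apply, toLpLin_apply, mulVec, dotProduct]
    ext i j
    rw [hMv, hentry, hgram, horth]
    simp [diagonal_apply, one_apply]

lemma exists_ne_zero_mulVec_eq_zero_of_rank_lt {K m n : Type*} [Field K] [Fintype n]
    {M : Matrix m n K} (h : M.rank < Fintype.card n) : ∃ x, x ≠ 0 ∧ M *ᵥ x = 0 := by
  have hker : LinearMap.ker M.mulVecLin ≠ ⊥ := fun hbot => by
    have := M.mulVecLin.finrank_range_add_finrank_ker
    rw [hbot, finrank_bot, finrank_fintype_fun_eq_card] at this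
    exact h.ne this
  obtain ⟨x, hx, hx0⟩ := Submodule.exists_mem_ne_zero_of_ne_bot hker
  exact ⟨x, hx0, hx⟩

theorem sigma_succ_le_of_rank_le {p q r : ℕ} (M : Matrix (Fin p) (Fin q) ℝ)
    {N : Matrix (Fin p) (Fin q) ℂ} (hN : N.rank ≤ r) : sigma M (r + 1) ≤ ‖complexify M - N‖ := by
  rcases le_or_gt q r with hq | hq
  · rw [sigma, Nat.add_sub_cancel, LinearMap.singularValues_of_finrank_le _ (by simpa using hq)]
    exact norm_nonneg _
  obtain ⟨U, hU, hMU⟩ := exists_transpose_mul_self_eq_diagonal_sigma_sq M (Nat.succ_le_of_lt hq)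
  obtain ⟨x, hx0, hx⟩ := exists_ne_zero_mulVec_eq_zero_of_rank_lt (M := N * complexify U)
    (by simpa using ((rank_mul_le_left _ _).trans hN).trans_lt (Nat.lt_succ_self r))
  have hxpos : 0 < ∑ k, ‖x k‖ ^ 2 := by
    obtain ⟨k, hk⟩ := Function.ne_iff.1 hx0
    exact Finset.sum_pos' (fun _ _ => sq_nonneg _)
      ⟨k, Finset.mem_univ k, pow_pos (norm_pos_iff.2 hk) 2⟩
  have hnormU : ‖WithLp.toLp 2 (complexify U *ᵥ x)‖ ^ 2 = ∑ k, ‖x k‖ ^ 2 := by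
    rw [norm_sq_mulVec_of_conjTranspose_mul_self_eq_diagonal (d := 1)]
    · simp
    · rw [conjTranspose_complexify, ← complexify_mul, hU, ← diagonal_one, complexify_diagonal]
      rfl
  have hnormMU : sigma M (r + 1) ^ 2 * ∑ k, ‖x k‖ ^ 2 ≤
      ‖WithLp.toLp 2 ((complexify M - N) *ᵥ (complexify U *ᵥ x))‖ ^ 2 := by
    rw [mulVec_mulVec, Matrix.sub_mul, sub_mulVec, hx, sub_zero, ← complexify_mul,
      norm_sq_mulVec_of_conjTranspose_mul_self_eq_diagonal
        (d := fun k : Fin (r + 1) => sigma M (k + 1) ^ 2), Finset.mul_sum]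
    · gcongr with k
      · exact LinearMap.singularValues_nonneg _ _
      · exact LinearMap.singularValues_antitone _ (by simpa using Nat.lt_succ_iff.1 k.2)
    · rw [conjTranspose_complexify, ← complexify_mul, hMU, complexify_diagonal]
  have hop : ‖WithLp.toLp 2 ((complexify M - N) *ᵥ (complexify U *ᵥ x))‖ ^ 2 ≤
      ‖complexify M - N‖ ^ 2 * ‖WithLp.toLp 2 (complexify U *ᵥ x)‖ ^ 2 := by
    rw [← mul_pow]
    gcongr
    exact l2_opNorm_mulVec _ (WithLp.toLp 2 (complexify U *ᵥ x))
  rw [hnormU] at hop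
  exact le_of_sq_le_sq (le_of_mul_le_mul_right (hnormMU.trans hop) hxpos) (norm_nonneg _)

end SingularValues

section EigenvectorMatrices

variable {n : ℕ} {M : Matrix (Fin n) (Fin n) ℝ}

lemma eigs_neg_transpose (M : Matrix (Fin n) (Fin n) ℝ) : eigs (-Mᵀ) = -eigs M := by
  have htranspose : complexify Mᵀ = (complexify M)ᵀ := rfl
  rw [eigs, eigs, complexify_neg, ← spectrum.neg_eq, htranspose]
  congr 1
  ext z
  rw [mem_spectrum_iff_isRoot_charpoly, mem_spectrum_iff_isRoot_charpoly, charpoly_transpose]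

lemma IsEigenvectorMatrix.neg_transpose {V : Matrix (Fin n) (Fin n) ℂ}
    (hV : IsEigenvectorMatrix M V) : IsEigenvectorMatrix (-Mᵀ) (V⁻¹)ᴴ := by
  obtain ⟨hunit, d, h⟩ := hV
  have hdet := (isUnit_iff_isUnit_det _).1 hunit
  have hleft : V⁻¹ * complexify M = diagonal d * V⁻¹ := by
    rw [← mul_nonsing_inv_cancel_right _ (V⁻¹ * complexify M) hdet, Matrix.mul_assoc V⁻¹, h,
      nonsing_inv_mul_cancel_left _ _ hdet]
  refine ⟨(isUnit_nonsing_inv_iff.2 hunit).star, -star d, ?_⟩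
  rw [complexify_neg, ← conjTranspose_complexify, Matrix.neg_mul, ← conjTranspose_mul, hleft,
    conjTranspose_mul, diagonal_conjTranspose, ← Matrix.mul_neg, diagonal_neg]
  rfl

lemma kappaEig_nonneg (M : Matrix (Fin n) (Fin n) ℝ) : 0 ≤ kappaEig M :=
  Real.sInf_nonneg (by rintro _ ⟨V, -, rfl⟩; positivity)

lemma kappaEig_le {V : Matrix (Fin n) (Fin n) ℂ} (hV : IsEigenvectorMatrix M V) :
    kappaEig M ≤ ‖V‖ * ‖V⁻¹‖ :=
  csInf_le ⟨0, by rintro _ ⟨V, -, rfl⟩; positivity⟩ ⟨V, hV, rfl⟩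

lemma le_kappaEig_mul (hM : IsDiagonalizable M) {s c : ℝ} (hc : 0 ≤ c)
    (h : ∀ V, IsEigenvectorMatrix M V → s ≤ ‖V‖ * ‖V⁻¹‖ * c) : s ≤ kappaEig M * c := by
  obtain ⟨V₀, hV₀⟩ := hM
  rcases hc.eq_or_lt with rfl | hc
  · simpa using h V₀ hV₀
  · rw [← div_le_iff₀ hc]
    refine le_csInf ⟨_, V₀, hV₀, rfl⟩ ?_
    rintro _ ⟨V, hV, rfl⟩
    exact (div_le_iff₀ hc).2 (h V hV)

lemma kappaEig_neg_transpose_le (hM : IsDiagonalizable M) : kappaEig (-Mᵀ) ≤ kappaEig M := by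
  rw [← mul_one (kappaEig M)]
  refine le_kappaEig_mul hM zero_le_one fun V hV => (kappaEig_le hV.neg_transpose).trans_eq ?_
  rw [← conjTranspose_nonsing_inv, nonsing_inv_nonsing_inv _ ((isUnit_iff_isUnit_det _).1 hV.1),
    l2_opNorm_conjTranspose, l2_opNorm_conjTranspose, mul_one, mul_comm]

theorem sigma_le_mul_toReal_zolotarev {m n k l h : ℕ} {M : Matrix (Fin m) (Fin m) ℝ}
    {N : Matrix (Fin n) (Fin n) ℝ} {V : Matrix (Fin m) (Fin m) ℂ} {W : Matrix (Fin n) (Fin n) ℂ}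
    (hV : IsEigenvectorMatrix M V) (hW : IsEigenvectorMatrix N W) {E G : Set ℂ} (hM : eigs M ⊆ G)
    (hN : eigs N ⊆ E) {U : Matrix (Fin m) (Fin k) ℝ} {R : Matrix (Fin n) (Fin l) ℝ} (hU : ‖U‖ ≤ 1)
    (hR : ‖R‖ ≤ 1) {Z : Matrix (Fin m) (Fin n) ℝ} {r : ℕ} (hr : (M * Z - Z * N).rank ≤ r) :
    sigma (Uᵀ * Z * R) (h * r + 1) ≤
      ‖V‖ * ‖V⁻¹‖ * (‖W‖ * ‖W⁻¹‖) * ‖Z‖ * (zolotarev h E G).toReal := by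
  obtain ⟨hV, b, hb⟩ := hV
  obtain ⟨hW, c, hc⟩ := hW
  refine le_mul_toReal_zolotarev (fun i => hM (mem_spectrum_of_mul_eq_mul_diagonal hV hb i))
    (fun i => hN (mem_spectrum_of_mul_eq_mul_diagonal hW hc i)) (by positivity)
    fun p q hp hq hpb hqc => ?_
  obtain ⟨Y, hrank, hnorm⟩ :=
    exists_rank_le_norm_sub_le hV hb hW hc (complexify Z) hp hq hpb hqc
  rw [← complexify_mul, ← complexify_mul, ← complexify_sub] at hrank
  have hcompress : complexify (Uᵀ * Z * R) - (complexify U)ᴴ * Y * complexify R =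
      (complexify U)ᴴ * (complexify Z - Y) * complexify R := by
    rw [complexify_mul, complexify_mul, ← conjTranspose_complexify, Matrix.mul_sub, Matrix.sub_mul]
  calc sigma (Uᵀ * Z * R) (h * r + 1)
      ≤ ‖complexify (Uᵀ * Z * R) - (complexify U)ᴴ * Y * complexify R‖ :=
        sigma_succ_le_of_rank_le _ ((rank_mul_le_left _ _).trans ((rank_mul_le_right _ _).trans
          (hrank.trans (Nat.mul_le_mul_left h ((rank_complexify_le _).trans hr)))))
    _ ≤ ‖(complexify U)ᴴ‖ * ‖complexify Z - Y‖ * ‖complexify R‖ := by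
        rw [hcompress]
        exact (l2_opNorm_mul _ _).trans
          (mul_le_mul_of_nonneg_right (l2_opNorm_mul _ _) (norm_nonneg _))
    _ ≤ 1 * ‖complexify Z - Y‖ * 1 := by
        rw [l2_opNorm_conjTranspose]
        gcongr
        exacts [(norm_complexify_le U).trans hU, (norm_complexify_le R).trans hR]
    _ ≤ _ := by
        rw [one_mul, mul_one]
        refine hnorm.trans ?_
        gcongr
        exact norm_complexify_le Z

theorem sigma_le_kappaEig_mul_toReal_zolotarev {m k l h : ℕ} {N : Matrix (Fin m) (Fin m) ℝ}
    (hM : IsDiagonalizable M) (hN : IsDiagonalizable N) {E G : Set ℂ} (hMG : eigs M ⊆ G)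
    (hNE : eigs N ⊆ E) {U : Matrix (Fin n) (Fin k) ℝ} {R : Matrix (Fin m) (Fin l) ℝ} (hU : ‖U‖ ≤ 1)
    (hR : ‖R‖ ≤ 1) {Z : Matrix (Fin n) (Fin m) ℝ} {r : ℕ} (hr : (M * Z - Z * N).rank ≤ r) :
    sigma (Uᵀ * Z * R) (h * r + 1) ≤
      kappaEig M * (kappaEig N * (‖Z‖ * (zolotarev h E G).toReal)) := by
  have hnonneg : 0 ≤ ‖Z‖ * (zolotarev h E G).toReal := by positivity
  refine le_kappaEig_mul hM (mul_nonneg (kappaEig_nonneg N) hnonneg) fun V hV => ?_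
  rw [mul_left_comm]
  refine le_kappaEig_mul hN (by positivity) fun W hW => ?_
  exact (sigma_le_mul_toReal_zolotarev hV hW hMG hNE hU hR hr).trans_eq (by ring)

end EigenvectorMatrices

section Displacement

variable {n : ℕ} {A F Q X A' F' Q' X' Y : Matrix (Fin n) (Fin n) ℝ}

lemma closedLoop_displacement (hF : F.IsHermitian) (hX : X.IsHermitian)
    (h : Aᵀ * X + X * A - X * F * X + Q = 0) (h' : A'ᵀ * X' + X' * A' - X' * F' * X' + Q' = 0) :
    -(closedLoop A F X)ᵀ * (X - X') - (X - X') * closedLoop A' F' X' =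
      X * (A - A') + (A - A')ᵀ * X' - X * (F - F') * X' + (Q - Q') := by
  have hexpand : -(Aᵀ - X * F) * (X - X') - (X - X') * (A' - F' * X') =
      X * (A - A') + (A - A')ᵀ * X' - X * (F - F') * X' + (Q - Q') -
      (Aᵀ * X + X * A - X * F * X + Q) + (A'ᵀ * X' + X' * A' - X' * F' * X' + Q') := by
    rw [transpose_sub]
    noncomm_ring
  rw [closedLoop, closedLoop, transpose_sub, transpose_mul,
    ← conjTranspose_eq_transpose_of_trivial X, ← conjTranspose_eq_transpose_of_trivial F, hX.eq,
    hF.eq, hexpand, h, h', sub_zero, add_zero]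

lemma IsStabilizingSolution.eq (hF : F.IsHermitian) (hX : IsStabilizingSolution A F Q X)
    (hY : IsStabilizingSolution A F Q Y) (hneg : ∀ z ∈ eigs (closedLoop A F X), z.re < 0) :
    X = Y := by
  have hsylvester : -(closedLoop A F X)ᵀ * (X - Y) = (X - Y) * closedLoop A F Y := by
    rw [← sub_eq_zero, closedLoop_displacement hF hX.posSemidef.isHermitian hX.care hY.care]
    simp
  have hdisj : Disjoint (eigs (-(closedLoop A F X)ᵀ)) (eigs (closedLoop A F Y)) := by
    refine Set.disjoint_left.2 fun z hzX hzY => ?_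
    rw [eigs_neg_transpose, Set.mem_neg] at hzX
    have := hneg _ hzX
    rw [Complex.neg_re] at this
    linarith [hY.stable z hzY]
  have hzero : complexify (X - Y) = 0 :=
    eq_zero_of_mul_eq_mul_of_disjoint_spectrum
      (by rw [← complexify_mul, hsylvester, complexify_mul]) hdisj
  exact sub_eq_zero.1 (complexify_injective (hzero.trans complexify_zero.symm))

lemma rank_closedLoop_displacement_le (hF : F.IsHermitian) (hX : X.IsHermitian)
    (h : Aᵀ * X + X * A - X * F * X + Q = 0) (h' : A'ᵀ * X' + X' * A' - X' * F' * X' + Q' = 0) :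
    (-(closedLoop A F X)ᵀ * (X - X') - (X - X') * closedLoop A' F' X').rank ≤
      2 * (A - A').rank + (F - F').rank + (Q - Q').rank := by
  have hA : (X * (A - A') + (A - A')ᵀ * X').rank ≤ (A - A').rank + (A - A').rank :=
    (rank_add_le _ _).trans (add_le_add (rank_mul_le_right _ _)
      ((rank_mul_le_left _ _).trans_eq (rank_transpose _)))
  have hFX : (-X * (F - F') * X').rank ≤ (F - F').rank :=
    (rank_mul_le_left _ _).trans (rank_mul_le_right _ _)
  rw [closedLoop_displacement hF hX h h', sub_eq_add_neg _ (X * (F - F') * X'), ← Matrix.neg_mul,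
    ← Matrix.neg_mul, two_mul]
  exact (rank_add_le _ _).trans (add_le_add_left ((rank_add_le _ _).trans (add_le_add hA hFX)) _)

end Displacement

section InclusionMatrix

variable {R ι κ : Type*}

lemma norm_le_one_of_transpose_mul_self_eq_one [Fintype ι] [Fintype κ] [DecidableEq κ]
    {U : Matrix ι κ ℝ} (h : Uᵀ * U = 1) : ‖U‖ ≤ 1 := by
  rw [← sq_le_one_iff₀ (norm_nonneg U), sq, ← l2_opNorm_conjTranspose_mul_self,
    conjTranspose_eq_transpose_of_trivial, h, ← diagonal_one, l2_opNorm_diagonal]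
  exact (pi_norm_le_iff_of_nonneg zero_le_one).2 fun _ => by simp

variable [DecidableEq ι]

/-- The matrix whose columns are the coordinate vectors selected by `e`, so that
`Uᵀ * M * U` is the submatrix of `M` at the indices `e`. -/
def inclusionMatrix (R : Type*) [Zero R] [One R] (e : κ → ι) : Matrix ι κ R :=
  (1 : Matrix ι ι R).submatrix id e

lemma transpose_inclusionMatrix_mul_mul [Fintype ι] [NonAssocSemiring R] {κ' : Type*} (e : κ → ι)
    (f : κ' → ι) (M : Matrix ι ι R) :
    (inclusionMatrix R f)ᵀ * M * inclusionMatrix R e = M.submatrix f e := by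
  ext i j
  simp [inclusionMatrix, Matrix.mul_apply, Matrix.one_apply]

lemma transpose_inclusionMatrix_mul [Fintype ι] [NonAssocSemiring R] {κ' : Type*} (e : κ → ι)
    (f : κ' → ι) :
    (inclusionMatrix R f)ᵀ * inclusionMatrix R e = (1 : Matrix ι ι R).submatrix f e := by
  rw [← transpose_inclusionMatrix_mul_mul, Matrix.mul_one]

variable [Fintype ι] [Fintype κ] [DecidableEq κ] {e : κ → ι} (he : Function.Injective e)
include he

lemma norm_inclusionMatrix_le : ‖inclusionMatrix ℝ e‖ ≤ 1 :=
  norm_le_one_of_transpose_mul_self_eq_one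
    ((transpose_inclusionMatrix_mul e e).trans (submatrix_one e he))

lemma norm_submatrix_le (M : Matrix ι ι ℝ) : ‖M.submatrix e e‖ ≤ ‖M‖ := by
  have hU := norm_inclusionMatrix_le he
  calc ‖M.submatrix e e‖ ≤ ‖(inclusionMatrix ℝ e)ᴴ‖ * ‖M‖ * ‖inclusionMatrix ℝ e‖ := by
        rw [← transpose_inclusionMatrix_mul_mul, conjTranspose_eq_transpose_of_trivial]
        exact (l2_opNorm_mul _ _).trans
          (mul_le_mul_of_nonneg_right (l2_opNorm_mul _ _) (norm_nonneg _))
    _ ≤ 1 * ‖M‖ * 1 := by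
        rw [l2_opNorm_conjTranspose]
        gcongr
    _ = ‖M‖ := by rw [one_mul, mul_one]

end InclusionMatrix

section SignFlip

variable {κ κ' ι R : Type*} {e : κ → ι} {f : κ' → ι}

lemma bijective_elim_swap (hef : Function.Bijective (Sum.elim e f)) :
    Function.Bijective (Sum.elim f e) := by
  have hswap : Sum.elim f e = Sum.elim e f ∘ Equiv.sumComm κ' κ :=
    funext fun x => by cases x <;> rfl
  rw [hswap]
  exact hef.comp (Equiv.sumComm κ' κ).bijective

variable [DecidableEq ι]

lemma submatrix_one_eq_zero [Zero R] [One R] (hef : Function.Injective (Sum.elim e f)) :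
    (1 : Matrix ι ι R).submatrix f e = 0 := by
  ext i j
  exact one_apply_ne fun hij => Sum.inr_ne_inl (hef (a₁ := Sum.inr i) (a₂ := Sum.inl j) hij)

variable [Fintype κ] [Fintype κ']

/-- The diagonal sign matrix with entries `1` at the indices `e` and `-1` at the indices `f`, for
`e` and `f` with complementary ranges. Conjugation by it changes the signs of exactly the two
off-diagonal blocks. -/
def signFlip (R : Type*) [Ring R] (e : κ → ι) (f : κ' → ι) : Matrix ι ι R :=
  inclusionMatrix R e * (inclusionMatrix R e)ᵀ - inclusionMatrix R f * (inclusionMatrix R f)ᵀ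

lemma transpose_signFlip [CommRing R] (e : κ → ι) (f : κ' → ι) :
    (signFlip R e f)ᵀ = signFlip R e f := by
  simp only [signFlip, transpose_sub, transpose_mul, transpose_transpose]

variable (hef : Function.Bijective (Sum.elim e f))
include hef

lemma inclusionMatrix_mul_transpose_add [NonAssocSemiring R] :
    inclusionMatrix R e * (inclusionMatrix R e)ᵀ + inclusionMatrix R f * (inclusionMatrix R f)ᵀ =
      1 := by
  have : Fintype ι := Fintype.ofSurjective _ hef.2
  ext i j
  calc _ = ∑ x : κ ⊕ κ', (1 : Matrix ι ι R) i (Sum.elim e f x) *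
        (1 : Matrix ι ι R) j (Sum.elim e f x) := (Fintype.sum_sum_type _).symm
    _ = ∑ y, (1 : Matrix ι ι R) i y * (1 : Matrix ι ι R) j y :=
        hef.sum_comp fun y => (1 : Matrix ι ι R) i y * (1 : Matrix ι ι R) j y
    _ = (1 : Matrix ι ι R) i j := by simp [one_apply]

variable [Fintype ι]

lemma sub_signFlip_mul_mul_signFlip [Ring R] (M : Matrix ι ι R) :
    M - signFlip R e f * M * signFlip R e f =
      2 • (inclusionMatrix R e * M.submatrix e f * (inclusionMatrix R f)ᵀ +
        inclusionMatrix R f * M.submatrix f e * (inclusionMatrix R e)ᵀ) := by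
  have hblocks : M =
      (inclusionMatrix R e * (inclusionMatrix R e)ᵀ + inclusionMatrix R f * (inclusionMatrix R f)ᵀ)
        * M *
      (inclusionMatrix R e * (inclusionMatrix R e)ᵀ +
        inclusionMatrix R f * (inclusionMatrix R f)ᵀ) := by
    rw [inclusionMatrix_mul_transpose_add hef, Matrix.one_mul, Matrix.mul_one]
  conv_lhs => enter [1]; rw [hblocks]
  simp only [signFlip, ← transpose_inclusionMatrix_mul_mul, ← Matrix.mul_assoc, two_smul,
    Matrix.mul_add, Matrix.add_mul, Matrix.sub_mul, Matrix.mul_sub]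
  abel

lemma signFlip_mul_self [Ring R] : signFlip R e f * signFlip R e f = 1 := by
  have hflip := sub_signFlip_mul_mul_signFlip hef (1 : Matrix ι ι R)
  rw [submatrix_one_eq_zero hef.1, submatrix_one_eq_zero (bijective_elim_swap hef).1] at hflip
  simp only [Matrix.mul_zero, Matrix.zero_mul, add_zero, smul_zero, Matrix.mul_one] at hflip
  exact (sub_eq_zero.1 hflip).symm

lemma rank_sub_signFlip_mul_mul_signFlip_le [Field R] (M : Matrix ι ι R) :
    (M - signFlip R e f * M * signFlip R e f).rank ≤
      (M.submatrix e f).rank + (M.submatrix f e).rank := by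
  rw [sub_signFlip_mul_mul_signFlip hef, smul_add, ← Matrix.smul_mul, ← Matrix.smul_mul,
    ← Matrix.smul_mul, ← Matrix.smul_mul]
  exact (rank_add_le _ _).trans (add_le_add
    ((rank_mul_le_left _ _).trans (rank_mul_le_right _ _))
    ((rank_mul_le_left _ _).trans (rank_mul_le_right _ _)))

lemma submatrix_sub_signFlip_mul_mul_signFlip [Ring R] (M : Matrix ι ι R) :
    (M - signFlip R e f * M * signFlip R e f).submatrix f e = 2 • M.submatrix f e := by
  classical
  rw [← transpose_inclusionMatrix_mul_mul, sub_signFlip_mul_mul_signFlip hef]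
  have hee := (transpose_inclusionMatrix_mul (R := R) e e).trans
    (submatrix_one e (hef.1.comp Sum.inl_injective))
  have hff := (transpose_inclusionMatrix_mul (R := R) f f).trans
    (submatrix_one f (hef.1.comp Sum.inr_injective))
  have hfe := (transpose_inclusionMatrix_mul (R := R) e f).trans (submatrix_one_eq_zero hef.1)
  simp only [Matrix.mul_smul, Matrix.smul_mul, Matrix.mul_add, ← Matrix.mul_assoc,
    hff, hfe, Matrix.zero_mul, Matrix.one_mul, zero_add]
  rw [Matrix.mul_assoc, hee, Matrix.mul_one]

end SignFlip

section Conjugation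

variable {n : ℕ} {J M A F Q X : Matrix (Fin n) (Fin n) ℝ} (hJ : J * J = 1)
include hJ

lemma eigs_conj : eigs (J * M * J) = eigs M := by
  have hJc : complexify J * complexify J = 1 := by rw [← complexify_mul, hJ, complexify_one]
  rw [eigs, complexify_mul, complexify_mul]
  exact spectrum.units_conjugate (u := ⟨complexify J, complexify J, hJc, hJc⟩)

lemma IsEigenvectorMatrix.conj {V : Matrix (Fin n) (Fin n) ℂ} (hV : IsEigenvectorMatrix M V) :
    IsEigenvectorMatrix (J * M * J) (complexify J * V) := by
  obtain ⟨hunit, d, h⟩ := hV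
  have hJc : complexify J * complexify J = 1 := by rw [← complexify_mul, hJ, complexify_one]
  refine ⟨(IsUnit.of_mul_eq_one _ hJc).mul hunit, d, ?_⟩
  rw [complexify_mul, complexify_mul, Matrix.mul_assoc _ (complexify J),
    ← Matrix.mul_assoc (complexify J) (complexify J), hJc, Matrix.one_mul, Matrix.mul_assoc, h,
    Matrix.mul_assoc]

lemma kappaEig_conj_le (hJt : Jᵀ = J) (hM : IsDiagonalizable M) :
    kappaEig (J * M * J) ≤ kappaEig M := by
  have hnorm : ‖complexify J‖ ≤ 1 := (norm_complexify_le J).trans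
    (norm_le_one_of_transpose_mul_self_eq_one (by rw [hJt, hJ]))
  have hinv : (complexify J)⁻¹ = complexify J :=
    inv_eq_left_inv (by rw [← complexify_mul, hJ, complexify_one])
  rw [← mul_one (kappaEig M)]
  refine le_kappaEig_mul hM zero_le_one fun V hV => (kappaEig_le (hV.conj hJ)).trans ?_
  rw [Matrix.mul_inv_rev, hinv, mul_one]
  gcongr
  · exact (l2_opNorm_mul _ _).trans (mul_le_of_le_one_left (norm_nonneg _) hnorm)
  · exact (l2_opNorm_mul _ _).trans (mul_le_of_le_one_right (norm_nonneg _) hnorm)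

lemma conj_mul_conj (M N : Matrix (Fin n) (Fin n) ℝ) :
    J * M * J * (J * N * J) = J * (M * N) * J := by
  simp only [Matrix.mul_assoc]
  rw [← Matrix.mul_assoc J J, hJ, Matrix.one_mul]

lemma closedLoop_conj :
    closedLoop (J * A * J) (J * F * J) (J * X * J) = J * closedLoop A F X * J := by
  rw [closedLoop, closedLoop, conj_mul_conj hJ, Matrix.mul_sub, Matrix.sub_mul]

lemma care_conj (hJt : Jᵀ = J) (h : Aᵀ * X + X * A - X * F * X + Q = 0) :
    (J * A * J)ᵀ * (J * X * J) + J * X * J * (J * A * J) - J * X * J * (J * F * J) * (J * X * J) +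
      J * Q * J = 0 := by
  have htranspose : (J * A * J)ᵀ = J * Aᵀ * J := by
    rw [transpose_mul, transpose_mul, hJt, Matrix.mul_assoc]
  rw [htranspose, conj_mul_conj hJ, conj_mul_conj hJ, conj_mul_conj hJ, conj_mul_conj hJ,
    ← Matrix.add_mul, ← Matrix.mul_add, ← Matrix.sub_mul, ← Matrix.mul_sub, ← Matrix.add_mul,
    ← Matrix.mul_add, h, Matrix.mul_zero, Matrix.zero_mul]

end Conjugation

section OffDiagonalBlocks

variable {n k l : ℕ} {A F Q X : Matrix (Fin n) (Fin n) ℝ}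

lemma norm_half_smul_sub_conj_le {J : Matrix (Fin n) (Fin n) ℝ} (hJ : ‖J‖ ≤ 1)
    (X : Matrix (Fin n) (Fin n) ℝ) : ‖(2⁻¹ : ℝ) • (X - J * X * J)‖ ≤ ‖X‖ := calc
  ‖(2⁻¹ : ℝ) • (X - J * X * J)‖ = 2⁻¹ * ‖X - J * X * J‖ := by
    rw [norm_smul, Real.norm_of_nonneg (by norm_num)]
  _ ≤ 2⁻¹ * (‖X‖ + ‖J‖ * ‖X‖ * ‖J‖) := by
    gcongr
    exact (norm_sub_le _ _).trans (add_le_add_right ((l2_opNorm_mul _ _).trans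
      (mul_le_mul_of_nonneg_right (l2_opNorm_mul _ _) (norm_nonneg _))) _)
  _ ≤ 2⁻¹ * (‖X‖ + 1 * ‖X‖ * 1) := by gcongr
  _ = ‖X‖ := by ring

lemma rank_sylvester_half_smul_sub_conj_le {J : Matrix (Fin n) (Fin n) ℝ} (hJ : J * J = 1)
    (hJt : Jᵀ = J) (hF : F.IsHermitian) (hX : X.IsHermitian)
    (hcare : Aᵀ * X + X * A - X * F * X + Q = 0) :
    (-(closedLoop A F X)ᵀ * ((2⁻¹ : ℝ) • (X - J * X * J)) -
      ((2⁻¹ : ℝ) • (X - J * X * J)) * (J * closedLoop A F X * J)).rank ≤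
      2 * (A - J * A * J).rank + (F - J * F * J).rank + (Q - J * Q * J).rank := by
  rw [Matrix.mul_smul, Matrix.smul_mul, ← smul_sub, ← closedLoop_conj hJ,
    rank_smul_of_mem_nonZeroDivisors _ (mem_nonZeroDivisors_of_ne_zero (by norm_num))]
  exact rank_closedLoop_displacement_le hF hX hcare (care_conj hJ hJt hcare)

theorem sigma_submatrix_le (hF : F.IsHermitian) (hX : X.IsHermitian)
    (hcare : Aᵀ * X + X * A - X * F * X + Q = 0) (hdiag : IsDiagonalizable (closedLoop A F X))
    {E : Set ℂ} (hE : eigs (closedLoop A F X) ⊆ E) {e : Fin k → Fin n} {f : Fin l → Fin n}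
    (hef : Function.Bijective (Sum.elim e f)) {h r : ℕ}
    (hr : 2 * ((A.submatrix e f).rank + (A.submatrix f e).rank) +
      ((F.submatrix e f).rank + (F.submatrix f e).rank) +
      ((Q.submatrix e f).rank + (Q.submatrix f e).rank) ≤ r) :
    sigma (X.submatrix f e) (h * r + 1) ≤
      kappaEig (closedLoop A F X) ^ 2 * (‖X‖ * (zolotarev h E (-E)).toReal) := by
  let J : Matrix (Fin n) (Fin n) ℝ := signFlip ℝ e f
  let C := closedLoop A F X
  let Z : Matrix (Fin n) (Fin n) ℝ := (2⁻¹ : ℝ) • (X - J * X * J)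
  have hJ : J * J = 1 := signFlip_mul_self hef
  have hJt : Jᵀ = J := transpose_signFlip e f
  have hrank : (-Cᵀ * Z - Z * (J * C * J)).rank ≤ r := by
    refine (rank_sylvester_half_smul_sub_conj_le hJ hJt hF hX hcare).trans (le_trans ?_ hr)
    gcongr <;> exact rank_sub_signFlip_mul_mul_signFlip_le hef _
  have hblock : X.submatrix f e = (inclusionMatrix ℝ f)ᵀ * Z * inclusionMatrix ℝ e := by
    rw [transpose_inclusionMatrix_mul_mul, submatrix_smul]
    change _ = (2⁻¹ : ℝ) • (X - J * X * J).submatrix f e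
    rw [submatrix_sub_signFlip_mul_mul_signFlip hef, ← Nat.cast_smul_eq_nsmul ℝ 2, Nat.cast_ofNat,
      inv_smul_smul₀ two_ne_zero]
  have hnorm : ‖Z‖ ≤ ‖X‖ := norm_half_smul_sub_conj_le
    (norm_le_one_of_transpose_mul_self_eq_one (by rw [hJt, hJ])) X
  have hJC : IsDiagonalizable (J * C * J) := hdiag.elim fun V hV => ⟨_, hV.conj hJ⟩
  have hCt : IsDiagonalizable (-Cᵀ) := hdiag.elim fun V hV => ⟨_, hV.neg_transpose⟩
  have hCtE : eigs (-Cᵀ) ⊆ -E := (eigs_neg_transpose C).trans_subset (Set.neg_subset_neg.2 hE)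
  calc sigma (X.submatrix f e) (h * r + 1)
      ≤ kappaEig (-Cᵀ) * (kappaEig (J * C * J) * (‖Z‖ * (zolotarev h E (-E)).toReal)) := by
        rw [hblock]
        exact sigma_le_kappaEig_mul_toReal_zolotarev hCt hJC hCtE ((eigs_conj hJ).trans_subset hE)
          (norm_inclusionMatrix_le (hef.1.comp Sum.inr_injective))
          (norm_inclusionMatrix_le (hef.1.comp Sum.inl_injective)) hrank
    _ ≤ kappaEig C * (kappaEig C * (‖X‖ * (zolotarev h E (-E)).toReal)) := by
        have := kappaEig_nonneg C
        gcongr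
        exacts [mul_nonneg (kappaEig_nonneg _) (by positivity), kappaEig_neg_transpose_le hdiag,
          kappaEig_conj_le hJ hJt hdiag]
    _ = kappaEig C ^ 2 * (‖X‖ * (zolotarev h E (-E)).toReal) := by ring

end OffDiagonalBlocks

section MaximalOffDiagonalBlocks

variable {n : ℕ}

lemma bijective_elim_firstIdx_lastIdx {s : ℕ} (hs : s ≤ n) :
    Function.Bijective (Sum.elim (firstIdx hs) (lastIdx (Nat.sub_le n s))) := by
  constructor
  · rintro (a | a) (b | b) h <;>
      simp only [Sum.elim_inl, Sum.elim_inr, firstIdx, lastIdx, Fin.ext_iff,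
        Fin.val_castLE] at h <;>
      simp only [Sum.inl.injEq, Sum.inr.injEq, reduceCtorEq, Fin.ext_iff] <;> omega
  · intro x
    by_cases hx : x.1 < s
    · exact ⟨Sum.inl ⟨x, hx⟩, rfl⟩
    · refine ⟨Sum.inr ⟨x - s, by omega⟩, ?_⟩
      simp only [Sum.elim_inr, lastIdx, Fin.ext_iff]
      omega

lemma rank_le_qsrank {M : Matrix (Fin n) (Fin n) ℝ}
    {B : (p : ℕ) × (q : ℕ) × Matrix (Fin p) (Fin q) ℝ} (hB : B ∈ Off M) :
    B.2.2.rank ≤ qsrank M := by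
  refine le_csSup ⟨n, ?_⟩ ⟨B, hB, rfl⟩
  rintro _ ⟨B', ⟨s, -, hs, rfl | rfl⟩, rfl⟩
  · exact (rank_le_width _).trans hs.le
  · exact (rank_le_width _).trans (Nat.sub_le n s)

theorem sigma_off_div_norm_le {A F Q X : Matrix (Fin n) (Fin n) ℝ} (hF : F.IsHermitian)
    (hX : X.IsHermitian) (hcare : Aᵀ * X + X * A - X * F * X + Q = 0)
    (hdiag : IsDiagonalizable (closedLoop A F X)) {E : Set ℂ} (hE : eigs (closedLoop A F X) ⊆ E)
    {B : (p : ℕ) × (q : ℕ) × Matrix (Fin p) (Fin q) ℝ} (hB : B ∈ Off X) (h : ℕ) :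
    sigma B.2.2 (h * (4 * qsrank A + 2 * qsrank F + 2 * qsrank Q) + 1) / ‖X‖ ≤
      kappaEig (closedLoop A F X) ^ 2 * (zolotarev h E (-E)).toReal := by
  refine div_le_of_le_mul₀ (norm_nonneg X) (by positivity) ?_
  rw [mul_right_comm, mul_assoc]
  obtain ⟨s, hs1, hs, hBs⟩ := hB
  have hfirst_last (M : Matrix (Fin n) (Fin n) ℝ) :
      (M.submatrix (firstIdx hs.le) (lastIdx (Nat.sub_le n s))).rank ≤ qsrank M :=
    rank_le_qsrank ⟨s, hs1, hs, Or.inr rfl⟩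
  have hlast_first (M : Matrix (Fin n) (Fin n) ℝ) :
      (M.submatrix (lastIdx (Nat.sub_le n s)) (firstIdx hs.le)).rank ≤ qsrank M :=
    rank_le_qsrank ⟨s, hs1, hs, Or.inl rfl⟩
  have hbij := bijective_elim_firstIdx_lastIdx hs.le
  rcases hBs with rfl | rfl
  · refine sigma_submatrix_le hF hX hcare hdiag hE hbij ?_
    linarith [hfirst_last A, hlast_first A, hfirst_last F, hlast_first F, hfirst_last Q,
      hlast_first Q]
  · refine sigma_submatrix_le hF hX hcare hdiag hE (bijective_elim_swap hbij) ?_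
    linarith [hfirst_last A, hlast_first A, hfirst_last F, hlast_first F, hfirst_last Q,
      hlast_first Q]

end MaximalOffDiagonalBlocks

section EigenvalueBounds

variable {ι : Type*} [Fintype ι] [DecidableEq ι] {A F Q X : Matrix ι ι ℂ}

lemma inv_le_inv_of_le {M N : Matrix ι ι ℂ} (hM : M.PosDef) (h : M ≤ N) : N⁻¹ ≤ M⁻¹ := by
  have hN : N.PosDef := by simpa using hM.add_posSemidef (Matrix.le_iff.1 h)
  obtain ⟨M, rfl⟩ := hM.isUnit
  obtain ⟨N, rfl⟩ := hN.isUnit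
  rw [← coe_units_inv, ← coe_units_inv]
  exact CStarAlgebra.inv_le_inv hM.posSemidef.nonneg h

lemma posDef_algebraMap {c : ℝ} (hc : 0 < c) : (algebraMap ℝ (Matrix ι ι ℂ) c).PosDef := by
  rw [algebraMap_eq_diagonal, posDef_diagonal_iff]
  exact fun _ => Complex.zero_lt_real.2 hc

lemma inv_algebraMap (c : ℝ) :
    (algebraMap ℝ (Matrix ι ι ℂ) c)⁻¹ = algebraMap ℝ (Matrix ι ι ℂ) c⁻¹ := by
  rcases eq_or_ne c 0 with rfl | hc
  · simp
  · exact inv_eq_left_inv (by rw [← map_mul, inv_mul_cancel₀ hc, map_one])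

lemma posDef_of_algebraMap_le {μ : ℝ} (hμ : 0 < μ) (hF : algebraMap ℝ _ μ ≤ F) : F.PosDef := by
  simpa only [add_sub_cancel] using (posDef_algebraMap hμ).add_posSemidef (Matrix.le_iff.1 hF)

lemma inv_le_algebraMap_inv {μ : ℝ} (hμ : 0 < μ) (hF : algebraMap ℝ _ μ ≤ F) :
    F⁻¹ ≤ algebraMap ℝ _ μ⁻¹ :=
  inv_algebraMap (ι := ι) μ ▸ inv_le_inv_of_le (posDef_algebraMap hμ) hF

lemma closedLoop_gram_eq (hF : F.PosDef) (hX : X.IsHermitian)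
    (hcare : Aᴴ * X + X * A - X * F * X + Q = 0) :
    (A - F * X)ᴴ * F⁻¹ * (A - F * X) = Aᴴ * F⁻¹ * A + Q := by
  have hdet := (isUnit_iff_isUnit_det _).1 hF.isUnit
  have hexpand : (Aᴴ - X * F) * F⁻¹ * (A - F * X) =
      Aᴴ * F⁻¹ * A - Aᴴ * X - X * A + X * F * X := by
    simp only [Matrix.sub_mul, Matrix.mul_sub, Matrix.mul_assoc,
      mul_nonsing_inv_cancel_left _ _ hdet, nonsing_inv_mul_cancel_left _ _ hdet]
    abel
  rw [conjTranspose_sub, conjTranspose_mul, hX.eq, hF.isHermitian.eq, hexpand, ← sub_eq_zero,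
    ← neg_eq_zero, ← hcare]
  abel

lemma algebraMap_le_closedLoop_gram {μ q : ℝ} (hμ : 0 < μ) (hF : algebraMap ℝ _ μ ≤ F)
    (hQ : algebraMap ℝ _ q ≤ Q) (hX : X.IsHermitian)
    (hcare : Aᴴ * X + X * A - X * F * X + Q = 0) :
    algebraMap ℝ _ (μ * q) ≤ (A - F * X)ᴴ * (A - F * X) := by
  have hFpos := posDef_of_algebraMap_le hμ hF
  have hAFA : 0 ≤ Aᴴ * F⁻¹ * A := star_left_conjugate_nonneg hFpos.inv.posSemidef.nonneg A
  calc algebraMap ℝ _ (μ * q) = μ • algebraMap ℝ (Matrix ι ι ℂ) q := by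
        rw [map_mul, ← Algebra.smul_def]
    _ ≤ μ • (Aᴴ * F⁻¹ * A + Q) := by gcongr; exact hQ.trans (le_add_of_nonneg_left hAFA)
    _ = μ • ((A - F * X)ᴴ * F⁻¹ * (A - F * X)) := by rw [closedLoop_gram_eq hFpos hX hcare]
    _ ≤ μ • ((A - F * X)ᴴ * algebraMap ℝ _ μ⁻¹ * (A - F * X)) := by
        gcongr
        exact star_left_conjugate_le_conjugate (inv_le_algebraMap_inv hμ hF) _
    _ = (A - F * X)ᴴ * (A - F * X) := by
        rw [← Algebra.commutes, ← Algebra.smul_def, Matrix.smul_mul, smul_inv_smul₀ hμ.ne']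

lemma norm_sq_closedLoop_le {μ φ q : ℝ} (hμ : 0 < μ) (hF : algebraMap ℝ _ μ ≤ F)
    (hφ : 0 < φ) (hFφ : F ≤ algebraMap ℝ _ φ)
    (hq : 0 ≤ q) (hQ : Q ≤ algebraMap ℝ _ q) (hX : X.IsHermitian)
    (hcare : Aᴴ * X + X * A - X * F * X + Q = 0) :
    ‖A - F * X‖ ^ 2 ≤ φ * (μ⁻¹ * ‖A‖ ^ 2 + q) := by
  have hFpos := posDef_of_algebraMap_le hμ hF
  have hFφinv : algebraMap ℝ _ φ⁻¹ ≤ F⁻¹ :=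
    inv_algebraMap (ι := ι) φ ▸ inv_le_inv_of_le hFpos hFφ
  rw [sq, ← l2_opNorm_conjTranspose_mul_self, CStarAlgebra.norm_le_iff_le_algebraMap _
    (by positivity) (posSemidef_conjTranspose_mul_self _).nonneg]
  calc (A - F * X)ᴴ * (A - F * X)
      = φ • ((A - F * X)ᴴ * algebraMap ℝ _ φ⁻¹ * (A - F * X)) := by
        rw [← Algebra.commutes, ← Algebra.smul_def, Matrix.smul_mul, smul_inv_smul₀ hφ.ne']
    _ ≤ φ • ((A - F * X)ᴴ * F⁻¹ * (A - F * X)) := by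
        gcongr
        exact star_left_conjugate_le_conjugate hFφinv _
    _ = φ • (Aᴴ * F⁻¹ * A + Q) := by rw [closedLoop_gram_eq hFpos hX hcare]
    _ ≤ φ • (Aᴴ * algebraMap ℝ _ μ⁻¹ * A + algebraMap ℝ _ q) := by
        gcongr
        exact star_left_conjugate_le_conjugate (inv_le_algebraMap_inv hμ hF) _
    _ = φ • (μ⁻¹ • (Aᴴ * A) + algebraMap ℝ _ q) := by
        rw [← Algebra.commutes, ← Algebra.smul_def, Matrix.smul_mul]
    _ ≤ φ • (μ⁻¹ • algebraMap ℝ _ (‖A‖ ^ 2) + algebraMap ℝ _ q) := by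
        gcongr
        exact CStarAlgebra.star_mul_le_algebraMap_norm_sq
    _ = algebraMap ℝ _ (φ * (μ⁻¹ * ‖A‖ ^ 2 + q)) := by
        rw [Algebra.smul_def, Algebra.smul_def, ← map_mul, ← map_add, ← map_mul]

lemma le_norm_sq_of_mem_spectrum {M : Matrix ι ι ℂ} {c : ℝ} (hM : algebraMap ℝ _ c ≤ Mᴴ * M) {z : ℂ}
    (hz : z ∈ spectrum ℂ M) : c ≤ ‖z‖ ^ 2 := by
  rw [← spectrum_toLin', ← End.hasEigenvalue_iff_mem_spectrum] at hz
  obtain ⟨v, hv⟩ := hz.exists_hasEigenvector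
  have hMv : M *ᵥ v = z • v := hv.apply_eq_smul
  have hvpos : 0 < star v ⬝ᵥ v := dotProduct_star_self_pos_iff.2 hv.2
  have hform : 0 ≤ ((‖z‖ ^ 2 - c : ℝ) : ℂ) * (star v ⬝ᵥ v) := by
    have := (Matrix.le_iff.1 hM).dotProduct_mulVec_nonneg v
    rwa [sub_mulVec, ← mulVec_mulVec, dotProduct_sub, dotProduct_mulVec, ← star_mulVec, hMv,
      star_smul, smul_dotProduct, dotProduct_smul, Algebra.algebraMap_eq_smul_one, smul_mulVec,
      one_mulVec, dotProduct_smul, smul_smul, smul_eq_mul, Complex.real_smul, ← sub_mul,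
      RCLike.star_def, Complex.conj_mul', ← Complex.ofReal_pow, ← Complex.ofReal_sub] at this
  exact sub_nonneg.1 (Complex.zero_le_real.1 (le_of_mul_le_mul_right (by simpa using hform) hvpos))

lemma mul_le_re_sq_of_mem_spectrum_closedLoop {μ q : ℝ} (hμ : 0 < μ) (hF : algebraMap ℝ _ μ ≤ F)
    (hQ : algebraMap ℝ _ q ≤ Q) (hX : X.IsHermitian)
    (hcare : Aᴴ * X + X * A - X * F * X + Q = 0) {z : ℂ} (hz : z ∈ spectrum ℂ (A - F * X)) :
    μ * q ≤ z.re ^ 2 := by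
  have hcare' : (A - algebraMap ℂ _ (z.im * Complex.I))ᴴ * X +
      X * (A - algebraMap ℂ _ (z.im * Complex.I)) - X * F * X + Q = 0 := by
    have hskew : (algebraMap ℂ (Matrix ι ι ℂ) (z.im * Complex.I))ᴴ =
        -algebraMap ℂ (Matrix ι ι ℂ) (z.im * Complex.I) := by
      rw [← star_eq_conjTranspose, ← algebraMap_star_comm, ← map_neg]
      simp
    rw [← hcare, conjTranspose_sub, hskew, Matrix.sub_mul, Matrix.mul_sub, Matrix.neg_mul,
      Algebra.commutes]
    abel
  have hshift : (z.re : ℂ) ∈ spectrum ℂ (A - algebraMap ℂ _ (z.im * Complex.I) - F * X) := by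
    rwa [sub_right_comm, sub_eq_neg_add _ (algebraMap ℂ _ _), ← spectrum.add_mem_iff,
      Complex.re_add_im]
  simpa using le_norm_sq_of_mem_spectrum
    (algebraMap_le_closedLoop_gram hμ hF hQ hX hcare') hshift

end EigenvalueBounds

section LambdaMin

lemma algebraMap_lambdaMin_le {n : ℕ} {Q : Matrix (Fin n) (Fin n) ℝ} (hQ : Q.IsHermitian) :
    algebraMap ℝ _ (lambdaMin Q) ≤ Q :=
  (algebraMap_le_iff_le_spectrum (a := Q) hQ.isSelfAdjoint).2 fun _ hc =>
    csInf_le Q.finite_real_spectrum.bddBelow hc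

lemma lambdaMin_pos {n : ℕ} [NeZero n] {Q : Matrix (Fin n) (Fin n) ℝ} (hQ : Q.PosDef) :
    0 < lambdaMin Q := by
  have hspec := hQ.isHermitian.spectrum_real_eq_range_eigenvalues
  obtain ⟨i, hi⟩ : lambdaMin Q ∈ Set.range hQ.isHermitian.eigenvalues :=
    hspec ▸ Set.Nonempty.csInf_mem (hspec ▸ Set.range_nonempty _) Q.finite_real_spectrum
  exact hi ▸ hQ.eigenvalues_pos i

lemma nonempty_of_mem_spectrum {ι R S : Type*} [Fintype ι] [DecidableEq ι] [CommSemiring R]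
    [CommRing S] [Algebra R S] {M : Matrix ι ι S} {c : R} (hc : c ∈ spectrum R M) : Nonempty ι := by
  by_contra hempty
  have := not_nonempty_iff.1 hempty
  simp only [spectrum.of_subsingleton, Set.mem_empty_iff_false] at hc

lemma norm_pos_of_isUnit {ι : Type*} [Fintype ι] [DecidableEq ι] [Nonempty ι] {F : Matrix ι ι ℝ}
    (hF : IsUnit F) : 0 < ‖F‖ :=
  norm_pos_iff.2 hF.ne_zero

lemma algebraMap_inv_norm_inv_le {ι : Type*} [Fintype ι] [DecidableEq ι] {F : Matrix ι ι ℝ}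
    (hF : F.PosDef) : algebraMap ℝ _ ‖F⁻¹‖⁻¹ ≤ F := by
  refine (algebraMap_le_iff_le_spectrum (a := F) hF.isHermitian.isSelfAdjoint).2 fun c hc => ?_
  have hcpos : 0 < c := by
    rw [hF.isHermitian.spectrum_real_eq_range_eigenvalues] at hc
    obtain ⟨i, rfl⟩ := hc
    exact hF.eigenvalues_pos i
  have hcinv : c⁻¹ ∈ spectrum ℝ F⁻¹ := by
    obtain ⟨F, rfl⟩ := hF.isUnit
    rw [← coe_units_inv]
    exact (spectrum.inv_mem_iff (r := Units.mk0 c hcpos.ne')).1 hc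
  have := nonempty_of_mem_spectrum hc
  exact inv_le_of_inv_le₀ hcpos
    ((Real.le_norm_self _).trans (spectrum.norm_le_norm_of_mem hcinv))

lemma submatrix_mono {ι κ : Type*} {M N : Matrix ι ι ℝ} (h : M ≤ N) (e : κ → ι) :
    M.submatrix e e ≤ N.submatrix e e := by
  rw [Matrix.le_iff]
  exact (Matrix.le_iff.1 h).submatrix e

lemma submatrix_algebraMap {ι κ : Type*} [Fintype ι] [Fintype κ] [DecidableEq ι] [DecidableEq κ]
    {e : κ → ι} (he : Function.Injective e) (c : ℝ) :
    (algebraMap ℝ (Matrix ι ι ℝ) c).submatrix e e = algebraMap ℝ (Matrix κ κ ℝ) c := by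
  rw [algebraMap_eq_diagonal, algebraMap_eq_diagonal, submatrix_diagonal _ _ he]
  rfl

end LambdaMin

section Subproblem

variable {n j : ℕ} [NeZero n] {A F Q : Matrix (Fin n) (Fin n) ℝ} (hF : F.PosDef)
  {e : Fin j → Fin n} (he : Function.Injective e) {Y : Matrix (Fin j) (Fin j) ℝ}
  (hY : IsStabilizingSolution (A.submatrix e e) (F.submatrix e e) (Q.submatrix e e) Y)
  {z : ℂ} (hz : z ∈ eigs (closedLoop (A.submatrix e e) (F.submatrix e e) Y))
include hF he hY hz

lemma re_le_of_mem_eigs_closedLoop_submatrix (hQ : Q.IsHermitian) :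
    z.re ≤ -√(lambdaMin Q / ‖F⁻¹‖) := by
  have hbound {M : Matrix (Fin n) (Fin n) ℝ} {c : ℝ} (h : algebraMap ℝ _ c ≤ M) :
      algebraMap ℝ _ c ≤ complexify (M.submatrix e e) := by
    rw [← complexify_algebraMap, ← submatrix_algebraMap he]
    exact complexify_mono (submatrix_mono h e)
  have hre : lambdaMin Q / ‖F⁻¹‖ ≤ z.re ^ 2 := by
    rw [div_eq_inv_mul]
    rw [eigs, complexify_closedLoop] at hz
    exact mul_le_re_sq_of_mem_spectrum_closedLoop (inv_pos.2 (norm_pos_of_isUnit hF.inv.isUnit))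
      (hbound (algebraMap_inv_norm_inv_le hF)) (hbound (algebraMap_lambdaMin_le hQ))
      (posSemidef_complexify hY.posSemidef).isHermitian (complexify_care hY.care) hz
  rw [le_neg, ← abs_of_nonpos (hY.stable z hz)]
  exact (Real.sqrt_le_sqrt hre).trans_eq (Real.sqrt_sq_eq_abs _)

lemma norm_le_of_mem_eigs_closedLoop_submatrix (hQ : Q.IsHermitian) : ‖z‖ ≤ rUpper A F Q := by
  have hlower : algebraMap ℝ _ ‖F⁻¹‖⁻¹ ≤ complexify (F.submatrix e e) := by
    rw [← complexify_algebraMap, ← submatrix_algebraMap he]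
    exact complexify_mono (submatrix_mono (algebraMap_inv_norm_inv_le hF) e)
  have hupper {M : Matrix (Fin n) (Fin n) ℝ} (h : M.IsHermitian) :
      complexify (M.submatrix e e) ≤ algebraMap ℝ _ ‖M‖ := by
    rw [← complexify_algebraMap, ← submatrix_algebraMap he]
    exact complexify_mono (submatrix_mono (le_algebraMap_norm h) e)
  have hnormA : ‖complexify (A.submatrix e e)‖ ≤ ‖A‖ :=
    (norm_complexify_le _).trans (norm_submatrix_le he A)
  rw [eigs, complexify_closedLoop] at hz
  have hnorm := norm_sq_closedLoop_le (inv_pos.2 (norm_pos_of_isUnit hF.inv.isUnit)) hlower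
    (norm_pos_of_isUnit hF.isUnit) (hupper hF.isHermitian) (norm_nonneg Q) (hupper hQ)
    (posSemidef_complexify hY.posSemidef).isHermitian (complexify_care hY.care)
  have := nonempty_of_mem_spectrum hz
  calc ‖z‖ ≤ √(‖F‖ * (‖F⁻¹‖ * ‖A‖ ^ 2 + ‖Q‖)) := by
        refine Real.le_sqrt_of_sq_le ?_
        rw [inv_inv] at hnorm
        refine (pow_le_pow_left₀ (norm_nonneg z) (spectrum.norm_le_norm_of_mem hz) 2).trans
          (hnorm.trans ?_)
        gcongr
    _ ≤ √(2 * ‖A‖ ^ 2 * cond2 F + ‖Q‖ * ‖F‖) := by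
        refine Real.sqrt_le_sqrt ?_
        rw [cond2]
        nlinarith [mul_nonneg (sq_nonneg ‖A‖) (mul_nonneg (norm_nonneg F) (norm_nonneg F⁻¹))]
    _ ≤ rUpper A F Q := le_add_of_nonneg_left (by positivity)

end Subproblem

section Subproblems

variable {n : ℕ} {A F Q X : Matrix (Fin n) (Fin n) ℝ} {Xl Xt : ∀ j : ℕ, Matrix (Fin j) (Fin j) ℝ}

lemma lastIdx_injective {j : ℕ} (hj : j ≤ n) : Function.Injective (lastIdx hj) := fun _ _ h =>
  Fin.ext (Nat.add_left_cancel (Fin.ext_iff.1 h))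

lemma finite_subproblemEigs (A F : Matrix (Fin n) (Fin n) ℝ)
    (Xl Xt : ∀ j : ℕ, Matrix (Fin j) (Fin j) ℝ) : (subproblemEigs A F Xl Xt).Finite :=
  (Set.finite_iUnion fun _ => Matrix.finite_spectrum _).union
    (Set.finite_iUnion fun _ => Matrix.finite_spectrum _)

lemma eigs_closedLoop_subset_subproblemEigs (hn : 1 ≤ n) (hX : Xl n = X) :
    eigs (closedLoop A F X) ⊆ subproblemEigs A F Xl Xt := fun _ hz =>
  Or.inl (Set.mem_iUnion.2 ⟨⟨n, hn, le_rfl⟩, hX ▸ hz⟩)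

lemma exists_isGreatest_re_subproblemEigs (hn : 1 ≤ n) (A F : Matrix (Fin n) (Fin n) ℝ)
    (Xl Xt : ∀ j : ℕ, Matrix (Fin j) (Fin j) ℝ) :
    ∃ w ∈ subproblemEigs A F Xl Xt, IsGreatest (Complex.re '' subproblemEigs A F Xl Xt) w.re := by
  have : Nonempty (Fin n) := ⟨⟨0, hn⟩⟩
  have hnonempty : (eigs (closedLoop A F (Xl n))).Nonempty :=
    spectrum.nonempty_of_isAlgClosed_of_finiteDimensional ℂ _
  obtain ⟨w, hw, hwmax⟩ := Set.exists_max_image _ Complex.re (finite_subproblemEigs A F Xl Xt)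
    (hnonempty.mono (eigs_closedLoop_subset_subproblemEigs hn rfl))
  exact ⟨w, hw, Set.mem_image_of_mem _ hw, Set.forall_mem_image.2 hwmax⟩

lemma kappaEig_sq_le_kappaConst (hn : 1 ≤ n) (hX : Xl n = X) :
    kappaEig (closedLoop A F X) ^ 2 ≤ kappaConst A F X Xl Xt := by
  rw [kappaConst, sq]
  refine mul_le_mul_of_nonneg_left (le_max_of_le_left ?_) (kappaEig_nonneg _)
  subst hX
  exact le_ciSup (f := fun j : Set.Icc 1 n =>
    kappaEig (closedLoop (leading A j.2.2) (leading F j.2.2) (Xl j)))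
    (Set.finite_range _).bddAbove ⟨n, hn, le_rfl⟩

lemma sqrt_lambdaMin_div_pos [NeZero n] (hF : F.PosDef) (hQ : Q.PosDef) :
    0 < √(lambdaMin Q / ‖F⁻¹‖) :=
  Real.sqrt_pos.2 (div_pos (lambdaMin_pos hQ) (norm_pos_of_isUnit hF.inv.isUnit))

lemma rLower_le [NeZero n] (hF : F.PosDef) (hQ : Q.PosDef) :
    rLower F Q ≤ √(lambdaMin Q / ‖F⁻¹‖) := by
  have hnorm := norm_pos_of_isUnit hF.inv.isUnit
  refine Real.sqrt_le_sqrt (div_le_div_of_nonneg_left (lambdaMin_pos hQ).le hnorm ?_)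
  linarith

variable (hF : F.PosDef) (hQ : Q.PosDef)
  (hXl : ∀ j : Set.Icc 1 n,
    IsStabilizingSolution (leading A j.2.2) (leading F j.2.2) (leading Q j.2.2) (Xl j))
  (hXt : ∀ j : Set.Icc 1 n,
    IsStabilizingSolution (trailing A j.2.2) (trailing F j.2.2) (trailing Q j.2.2) (Xt j))
include hF hQ hXl hXt

lemma mem_annulusPart_of_mem_subproblemEigs [NeZero n] {z : ℂ} (hz : z ∈ subproblemEigs A F Xl Xt) :
    z ∈ annulusPart √(lambdaMin Q / ‖F⁻¹‖) (rLower F Q) (rUpper A F Q) := by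
  obtain ⟨hre, hnorm⟩ : z.re ≤ -√(lambdaMin Q / ‖F⁻¹‖) ∧ ‖z‖ ≤ rUpper A F Q := by
    rcases hz with hz | hz <;> obtain ⟨j, hj⟩ := Set.mem_iUnion.1 hz
    · have he := Fin.castLE_injective j.2.2
      exact ⟨re_le_of_mem_eigs_closedLoop_submatrix hF he (hXl j) hj hQ.isHermitian,
        norm_le_of_mem_eigs_closedLoop_submatrix hF he (hXl j) hj hQ.isHermitian⟩
    · have he := lastIdx_injective j.2.2
      exact ⟨re_le_of_mem_eigs_closedLoop_submatrix hF he (hXt j) hj hQ.isHermitian,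
        norm_le_of_mem_eigs_closedLoop_submatrix hF he (hXt j) hj hQ.isHermitian⟩
  refine ⟨hre, ?_, hnorm⟩
  calc rLower F Q ≤ √(lambdaMin Q / ‖F⁻¹‖) := rLower_le hF hQ
    _ ≤ -z.re := le_neg_of_le_neg hre
    _ ≤ ‖z‖ := (neg_le_abs _).trans (Complex.abs_re_le_norm z)

lemma leading_solution_eq (hn : 1 ≤ n) (hX : IsStabilizingSolution A F Q X) : Xl n = X := by
  have : NeZero n := ⟨by omega⟩
  refine IsStabilizingSolution.eq hF.isHermitian (hXl ⟨n, hn, le_rfl⟩) hX fun z hz => ?_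
  exact (mem_annulusPart_of_mem_subproblemEigs hF hQ hXl hXt
    (eigs_closedLoop_subset_subproblemEigs hn rfl hz)).1.trans_lt
    (neg_neg_of_pos (sqrt_lambdaMin_div_pos hF hQ))

end Subproblems

end Riccati

theorem corollary2p6_general {n : ℕ} (hn : 1 ≤ n) {A F Q X : Matrix (Fin n) (Fin n) ℝ}
    (hF : F.PosDef) (hQ : Q.PosDef) (hX : IsStabilizingSolution A F Q X)
    (hdiag : IsDiagonalizable (closedLoop A F X)) {Xl Xt : ∀ j : ℕ, Matrix (Fin j) (Fin j) ℝ}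
    (hXl : ∀ j : Set.Icc 1 n,
      IsStabilizingSolution (leading A j.2.2) (leading F j.2.2) (leading Q j.2.2) (Xl j))
    (hXt : ∀ j : Set.Icc 1 n,
      IsStabilizingSolution (trailing A j.2.2) (trailing F j.2.2) (trailing Q j.2.2) (Xt j)) :
    ∃ τ : ℝ, 0 < τ ∧ √(lambdaMin Q / ‖F⁻¹‖) ≤ τ ∧
      IsGreatest (Complex.re '' subproblemEigs A F Xl Xt) (-τ) ∧
      subproblemEigs A F Xl Xt ⊆ annulusPart τ (rLower F Q) (rUpper A F Q) ∧
      ∀ B ∈ Off X, ∀ h : ℕ,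
        sigma B.2.2 (h * (4 * qsrank A + 2 * qsrank F + 2 * qsrank Q) + 1) / ‖X‖ ≤
          kappaEig (closedLoop A F X) ^ 2 *
            (zolotarev h (annulusPart τ (rLower F Q) (rUpper A F Q))
              (-annulusPart τ (rLower F Q) (rUpper A F Q))).toReal := by
  have : NeZero n := ⟨by omega⟩
  have hmem {z : ℂ} (hz : z ∈ subproblemEigs A F Xl Xt) :=
    mem_annulusPart_of_mem_subproblemEigs hF hQ hXl hXt hz
  obtain ⟨w, hw, hmax⟩ := exists_isGreatest_re_subproblemEigs hn A F Xl Xt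
  have hE : subproblemEigs A F Xl Xt ⊆ annulusPart (-w.re) (rLower F Q) (rUpper A F Q) :=
    fun z hz => ⟨(neg_neg w.re).symm ▸ hmax.2 (Set.mem_image_of_mem _ hz), (hmem hz).2⟩
  have hXn : Xl n = X := leading_solution_eq hF hQ hXl hXt hn hX
  have hτ : √(lambdaMin Q / ‖F⁻¹‖) ≤ -w.re := le_neg_of_le_neg (hmem hw).1
  exact ⟨-w.re, (sqrt_lambdaMin_div_pos hF hQ).trans_le hτ, hτ, (neg_neg w.re).symm ▸ hmax, hE,
    fun B hB h => sigma_off_div_norm_le hF.isHermitian hX.posSemidef.isHermitian hX.care hdiag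
      ((eigs_closedLoop_subset_subproblemEigs hn hXn).trans hE) hB h⟩

theorem corollary2p6 (n ra rf rq : ℕ) (hn : 1 ≤ n)
    (A F Q X : Matrix (Fin n) (Fin n) ℝ)
    (hA : qsrank A = ra) (hF : qsrank F = rf) (hQ : qsrank Q = rq)
    (hW : numRange A ⊆ {z : ℂ | z.re < 0})
    (hFpos : F.PosDef) (hQpos : Q.PosDef)
    (hX : IsStabilizingSolution A F Q X)
    (Xl Xt : ∀ j : ℕ, Matrix (Fin j) (Fin j) ℝ)
    (hXl : ∀ j : Set.Icc 1 n,
      IsStabilizingSolution (leading A j.2.2) (leading F j.2.2) (leading Q j.2.2) (Xl j))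
    (hXt : ∀ j : Set.Icc 1 n,
      IsStabilizingSolution (trailing A j.2.2) (trailing F j.2.2) (trailing Q j.2.2) (Xt j))
    (hdl : ∀ j : Set.Icc 1 n,
      IsDiagonalizable (closedLoop (leading A j.2.2) (leading F j.2.2) (Xl j)))
    (hdt : ∀ j : Set.Icc 1 n,
      IsDiagonalizable (closedLoop (trailing A j.2.2) (trailing F j.2.2) (Xt j))) :
    ∃ τ : ℝ, 0 < τ ∧
      IsGreatest (Complex.re '' subproblemEigs A F Xl Xt) (-τ) ∧
      subproblemEigs A F Xl Xt ⊆ annulusPart τ (rLower F Q) (rUpper A F Q) ∧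
      (∀ B ∈ Off X, ∀ h : ℕ, 1 ≤ h →
        sigma B.2.2 (h * (4 * ra + 2 * rf + 2 * rq) + 1) / ‖X‖ ≤
          kappaConst A F X Xl Xt *
            (zolotarev h (annulusPart τ (rLower F Q) (rUpper A F Q))
              (-annulusPart τ (rLower F Q) (rUpper A F Q))).toReal) ∧
      (∀ L : Matrix (Fin n) (Fin n) ℝ, IsCholeskyFactor L F →
        ‖Lᵀ * A * (Lᵀ)⁻¹ - L⁻¹ * Aᵀ * L‖ ^ 2 / 4 < lambdaMin Q / ‖F⁻¹‖ →
          √(lambdaMin Q / ‖F⁻¹‖ - ‖Lᵀ * A * (Lᵀ)⁻¹ - L⁻¹ * Aᵀ * L‖ ^ 2 / 4) ≤ τ ∧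
          0 < √(lambdaMin Q / ‖F⁻¹‖ - ‖Lᵀ * A * (Lᵀ)⁻¹ - L⁻¹ * Aᵀ * L‖ ^ 2 / 4)) := by
  subst hA hF hQ
  have hXn := leading_solution_eq hFpos hQpos hXl hXt hn hX
  obtain ⟨τ, hτ0, hτ, hmax, hE, hσ⟩ :=
    corollary2p6_general hn hFpos hQpos hX (hXn ▸ hdl ⟨n, hn, le_rfl⟩) hXl hXt
  refine ⟨τ, hτ0, hmax, hE, fun B hB h _ => (hσ B hB h).trans ?_, fun L _ hL => ?_⟩
  · gcongr
    exact kappaEig_sq_le_kappaConst hn hXn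
  · exact ⟨(Real.sqrt_le_sqrt (sub_le_self _ (by positivity))).trans hτ,
      Real.sqrt_pos.2 (sub_pos.2 hL)⟩
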